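/- Let $n\ge 0$, $T>0$, $I=[0,T]$, $I_0=(0,T)$, $\Omega=\mathbb R^n/\mathbb Z^n$; functions on $\Omega$ are identified with $\mathbb Z^n$-periodic functions on $\mathbb R^n$. Let $P\in C^1(\Omega\times I)$. For $x,y\in\mathbb R^n$ and $t_1<t_2$ in $I$ let $$J_P(x,y,t_1,t_2)=\inf_{\gamma}\int_{t_1}^{t_2}\Big[\tfrac12|\dot\gamma(t)|^2+P(\gamma(t),t)\Big]dt ,$$ the infimum being over all $C^1$ curves $\gamma:[t_1,t_2]\to\mathbb R^n$ with $\gamma(t_1)=x$, $\gamma(t_2)=y$. A function $\phi:\Omega\times I\to\mathbb R$ is a forward solution of the Hamilton--Jacobi equation $$\phi_t+\tfrac12|\nabla_x\phi|^2=P \qquad (\mathrm{HJ})$$ if $\phi(x,t_1)=\inf_{y\in\mathbb R^n}[J_P(y,x,t_0,t_1)+\phi(y,t_0)]$ for all $x$ and all $t_0<t_1$ in $I$, and a backward solution if $\phi(x,t_0)=\sup_{y\in\mathbb R^n}[-J_P(x,y,t_0,t_1)+\phi(y,t_1)]$ for all $x$ and all $t_0<t_1$ in $I$. Let $\{\overline\phi,\underline\phi\}$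 be a reversible pair, i.e. $\overline\phi$ is a forward solution, $\underline\phi$ is a backward solution, and $\overline\phi(\cdot,0)=\underline\phi(\cdot,0)$, $\overline\phi(\cdot,T)=\underline\phi(\cdot,T)$ on $\Omega$. Put $$K_0=\{(x,t)\in\Omega\times I_0:\ \overline\phi(x,t)=\underline\phi(x,t)\}.$$ Then $\overline\phi$ and $\underline\phi$ are differentiable (jointly in $(x,t)$) at every point of $K_0$, their gradients coincide there, $(\nabla_x\overline\phi,\overline\phi_t)=(\nabla_x\underline\phi,\underline\phi_t)$ on $K_0$, and both functions satisfy (HJ) at every point of $K_0$. If, in addition, there is a positive locally integrable (for instance, a continuous) function $C$ on $I_0$ such that $x\mapsto P(x,t)-C(t)|x|^2$ is concave on $\mathbb R^n$ for every $t\in I_0$, then the common full gradient $(\nabla_x\phi,\phi_t)$, and in particular $\nabla_x\phi$, is locally Lipschitz on $K_0$ as a function of $(x,t)$. -/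

import Mathlib

open MeasureTheory Set

noncomputable section

namespace HamiltonJacobi

/-- The covering space `ℝⁿ` of the flat torus `Ω = ℝⁿ / ℤⁿ`, with the Euclidean norm. -/
abbrev Space (n : ℕ) : Type := EuclideanSpace ℝ (Fin n)

/-- The vector of `ℝⁿ` with the integer coordinates `z`. -/
def latticeVector {n : ℕ} (z : Fin n → ℤ) : Space n :=
  WithLp.toLp 2 (fun i => (z i : ℝ))

/-- `f` is a function on `Ω × [0,T]`, i.e. `f(·,t)` is `ℤⁿ`-periodic for every `t ∈ [0,T]`.
Values of `f` at times outside `[0,T]` play no role. -/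
def IsTorusFunction {n : ℕ} (T : ℝ) (f : Space n × ℝ → ℝ) : Prop :=
  ∀ (z : Fin n → ℤ) (x : Space n), ∀ t ∈ Icc (0 : ℝ) T, f (x + latticeVector z, t) = f (x, t)

/-- The action `∫_{t₁}^{t₂} (|γ'|²/2 + P(γ(t),t)) dt` of the orbit `γ`. -/
def orbitAction {n : ℕ} (P : Space n × ℝ → ℝ) (t₁ t₂ : ℝ) (γ : ℝ → Space n) : ℝ :=
  ∫ t in t₁..t₂, (‖deriv γ t‖ ^ 2 / 2 + P (γ t, t))

/-- `J_P(x,y,t₁,t₂)`: the infimum of the action over the `C¹` orbits in `ℝⁿ` from `x` at time `t₁`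
to `y` at time `t₂`. (Every `C¹` orbit on `[t₁,t₂]` is the restriction of a `C¹` orbit on `ℝ`,
and only its values on `[t₁,t₂]` enter the action.) -/
def minimalAction {n : ℕ} (P : Space n × ℝ → ℝ) (x y : Space n) (t₁ t₂ : ℝ) : ℝ :=
  sInf {A : ℝ | ∃ γ : ℝ → Space n,
    ContDiff ℝ 1 γ ∧ γ t₁ = x ∧ γ t₂ = y ∧ A = orbitAction P t₁ t₂ γ}

/-- Forward solutions of `φ_t + |∇ₓφ|²/2 = P` on `Ω × [0,T]`:
`φ(x,t₁) = inf_y [J_P(y,x,t₀,t₁) + φ(y,t₀)]` for all `t₀ < t₁` in `[0,T]`. -/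
structure IsForwardSolution {n : ℕ} (T : ℝ) (P φ : Space n × ℝ → ℝ) : Prop where
  periodic : IsTorusFunction T φ
  isGLB : ∀ (x : Space n), ∀ t₀ ∈ Icc (0 : ℝ) T, ∀ t₁ ∈ Icc (0 : ℝ) T, t₀ < t₁ →
    IsGLB (range fun y : Space n => minimalAction P y x t₀ t₁ + φ (y, t₀)) (φ (x, t₁))

/-- Backward solutions of `φ_t + |∇ₓφ|²/2 = P` on `Ω × [0,T]`:
`φ(x,t₀) = sup_y [-J_P(x,y,t₀,t₁) + φ(y,t₁)]` for all `t₀ < t₁` in `[0,T]`. -/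
structure IsBackwardSolution {n : ℕ} (T : ℝ) (P φ : Space n × ℝ → ℝ) : Prop where
  periodic : IsTorusFunction T φ
  isLUB : ∀ (x : Space n), ∀ t₀ ∈ Icc (0 : ℝ) T, ∀ t₁ ∈ Icc (0 : ℝ) T, t₀ < t₁ →
    IsLUB (range fun y : Space n => -minimalAction P x y t₀ t₁ + φ (y, t₁)) (φ (x, t₀))

/-- A reversible pair: a forward solution `φf` and a backward solution `φb` which agree at
`t = 0` and at `t = T`. -/
structure IsReversiblePair {n : ℕ} (T : ℝ) (P φf φb : Space n × ℝ → ℝ) : Prop where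
  forward : IsForwardSolution T P φf
  backward : IsBackwardSolution T P φb
  initial : ∀ x : Space n, φf (x, 0) = φb (x, 0)
  final : ∀ x : Space n, φf (x, T) = φb (x, T)

/-- The reversibility set `K₀ = {(x,t) ; 0 < t < T, φf(x,t) = φb(x,t)}`. -/
def reversibilitySet {n : ℕ} (T : ℝ) (φf φb : Space n × ℝ → ℝ) : Set (Space n × ℝ) :=
  {p | p.2 ∈ Ioo (0 : ℝ) T ∧ φf p = φb p}

/-- The spatial gradient `∇ₓφ`. -/
def spaceGradient {n : ℕ} (φ : Space n × ℝ → ℝ) (p : Space n × ℝ) : Space n :=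
  gradient (fun x => φ (x, p.2)) p.1

/-- The time derivative `φ_t`. -/
def timeDerivative {n : ℕ} (φ : Space n × ℝ → ℝ) (p : Space n × ℝ) : ℝ :=
  deriv (fun t => φ (p.1, t)) p.2

/-- The full gradient `∇φ = {∇ₓφ, φ_t}`. -/
def fullGradient {n : ℕ} (φ : Space n × ℝ → ℝ) (p : Space n × ℝ) : Space n × ℝ :=
  (spaceGradient φ p, timeDerivative φ p)

/-- The equation `φ_t + |∇ₓφ|²/2 = P` at the point `p`. -/
def SatisfiesHJAt {n : ℕ} (P φ : Space n × ℝ → ℝ) (p : Space n × ℝ) : Prop :=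
  timeDerivative φ p + ‖spaceGradient φ p‖ ^ 2 / 2 = P p

/-- There is a positive, locally integrable function `C` on `(0,T)` such that
`x ↦ P(x,t) - C(t)|x|²` is concave on `ℝⁿ` for every `t ∈ (0,T)`. -/
def IsSemiconcavePressure {n : ℕ} (T : ℝ) (P : Space n × ℝ → ℝ) : Prop :=
  ∃ C : ℝ → ℝ, LocallyIntegrableOn C (Ioo (0 : ℝ) T) volume ∧
    ∀ t ∈ Ioo (0 : ℝ) T, 0 < C t ∧
      ConcaveOn ℝ univ (fun x : Space n => P (x, t) - C t * ‖x‖ ^ 2)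

end HamiltonJacobi

end

/-! A forward solution is an infimum of action costs. So near `(x₀,t₀)` it lies below the cost of
moving the endpoint of a near-minimizing orbit. A backward solution is a forward one under time
reversal and a sign change, so it has matching lower bounds. Always `φb ≤ φf`, with equality on
`K₀`, where the two kinds of bound pinch both functions.

Differentiability needs no minimizers, only orbits on `[t₀-δ,t₀]` that are optimal up to `δ²`. Their
mean velocity `u` is bounded independently of `δ`. Comparison with straight segments from the same
starting point gives, with `r` the size of the displacement, a first-order upper bound with slope
`(u, P - |u|²/2)` and error `O(r²/δ + δ²)` (`exists_upper_estimate`). At `r ~ δ^(3/2)` the error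
divided by `r` is `O(δ^(1/2))`. Hence along geometric scales the slopes are Cauchy, and their limit
is the derivative of both functions (`exists_hasFDerivAt_of_squeeze`). The slopes `(u, P - |u|²/2)`
form a closed set, so the limit satisfies the equation.

If `P` is semiconcave in space, displacing one near-optimal orbit in two opposite directions makes
`φf` semiconcave, and `-φb` likewise by reversal. On `K₀` this yields two-sided quadratic bounds at
fixed time, with a constant uniform on compact time intervals (`exists_quadratic_estimate`). The
forward dynamics carries such bounds to later times (`upper_of_later`, `lower_of_later`). Comparing
the expansions at two nearby points of `K₀`, tested on displacements no larger than their distance,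
bounds the difference of spatial gradients by a multiple of that distance. The equation then handles
the time derivative. -/

open MeasureTheory Set

noncomputable section

namespace HamiltonJacobi

/-! ### Bounds on the pressure and on the action of orbits -/

section

variable {n : ℕ} {T B L : ℝ} {P φ : Space n × ℝ → ℝ}

/-- `P` is bounded by `B` and `L`-Lipschitz on `ℝⁿ × [0,T]`. -/
structure LipschitzPressure (T B L : ℝ) (P : Space n × ℝ → ℝ) : Prop where
  nonneg_bound : 0 ≤ B
  nonneg_lip : 0 ≤ L
  bound : ∀ x, ∀ t ∈ Icc 0 T, |P (x, t)| ≤ B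
  lip : ∀ x y, ∀ t ∈ Icc 0 T, ∀ s ∈ Icc 0 T, |P (x, t) - P (y, s)| ≤ L * (‖x - y‖ + |t - s|)

lemma exists_latticeVector_norm_le (x : Space n) :
    ∃ z : Fin n → ℤ, ‖x + latticeVector z‖ ≤ √n := by
  refine ⟨fun i => -⌊x i⌋, ?_⟩
  rw [EuclideanSpace.norm_eq]
  apply Real.sqrt_le_sqrt
  calc ∑ i, ‖(x + latticeVector fun i => -⌊x i⌋) i‖ ^ 2 ≤ ∑ _i : Fin n, (1 : ℝ) := by
        refine Finset.sum_le_sum fun i _ => ?_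
        have h1 := Int.floor_le (x i)
        have h2 := Int.lt_floor_add_one (x i)
        have : (x + latticeVector fun i => -⌊x i⌋) i = x i - ⌊x i⌋ := by
          simp [latticeVector, ← sub_eq_add_neg]
        rw [this, Real.norm_eq_abs, sq_abs]
        nlinarith
    _ = n := by simp

/-- Periodicity reduces to a compact convex set, where a `C¹` function is Lipschitz. The radius `√n
+ 1` leaves room to translate two points at distance at most 1 by the same lattice vector. For
points farther apart the bound on `P` suffices, whence the extra `2 * max B 0`. -/
lemma exists_lipschitzPressure (hPper : IsTorusFunction T P)
    (hP : ContDiffOn ℝ 1 P (univ ×ˢ Icc (0 : ℝ) T)) :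
    ∃ B L, LipschitzPressure T B L P := by
  set S : Set (Space n × ℝ) := Metric.closedBall 0 (√n + 1) ×ˢ Icc (0 : ℝ) T with hS
  have hSc : IsCompact S := (isCompact_closedBall _ _).prod isCompact_Icc
  have hSconv : Convex ℝ S := (convex_closedBall _ _).prod (convex_Icc _ _)
  have hPS : ContDiffOn ℝ 1 P S := hP.mono (prod_mono (subset_univ _) subset_rfl)
  obtain ⟨B, hB⟩ := hSc.exists_bound_of_continuousOn hPS.continuousOn
  obtain ⟨L, hL⟩ := hPS.exists_lipschitzOnWith (by norm_num) hSconv hSc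
  have hbd : ∀ x, ∀ t ∈ Icc 0 T, |P (x, t)| ≤ max B 0 := by
    intro x t ht
    obtain ⟨z, hz⟩ := exists_latticeVector_norm_le x
    rw [← hPper z x t ht]
    refine (hB _ ⟨?_, ht⟩).trans (le_max_left _ _)
    simpa using hz.trans (by linarith)
  have hL0 : (0 : ℝ) ≤ L := L.2
  have hB0 : 0 ≤ max B 0 := le_max_right _ _
  refine ⟨max B 0, L + 2 * max B 0, le_max_right _ _, by positivity, hbd, ?_⟩
  intro x y t ht s hs
  rcases le_total ‖x - y‖ 1 with h | h
  · obtain ⟨z, hz⟩ := exists_latticeVector_norm_le x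
    rw [← hPper z x t ht, ← hPper z y s hs]
    have h1 : (x + latticeVector z, t) ∈ S := ⟨by simpa using hz.trans (by linarith), ht⟩
    have h2 : (y + latticeVector z, s) ∈ S := by
      refine ⟨?_, hs⟩
      have : ‖y + latticeVector z‖ ≤ ‖x + latticeVector z‖ + ‖x - y‖ := by
        have := norm_sub_le (x + latticeVector z) (x - y)
        simpa [sub_add_eq_add_sub, add_comm] using this
      simpa using this.trans (by linarith)
    have h3 := hL.dist_le_mul _ h1 _ h2
    rw [Real.dist_eq, Prod.dist_eq] at h3
    refine h3.trans ?_
    have h4 : max (dist (x + latticeVector z) (y + latticeVector z)) (dist t s)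
        ≤ ‖x - y‖ + |t - s| := by
      refine max_le ?_ ?_
      · rw [dist_add_right, dist_eq_norm]; linarith [abs_nonneg (t - s)]
      · rw [Real.dist_eq]; linarith [norm_nonneg (x - y)]
    calc _ ≤ (L : ℝ) * (‖x - y‖ + |t - s|) := by gcongr
      _ ≤ _ := by gcongr; linarith
  · have h1 := abs_le.1 (hbd x t ht)
    have h2 := abs_le.1 (hbd y s hs)
    have h3 : |P (x, t) - P (y, s)| ≤ 2 * max B 0 := abs_le.2 ⟨by linarith, by linarith⟩
    have h4 : 1 ≤ ‖x - y‖ + |t - s| := by linarith [abs_nonneg (t - s)]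
    nlinarith

/-- Reversal of time in `[0,T]`. -/
def reverse (T : ℝ) (f : Space n × ℝ → ℝ) (p : Space n × ℝ) : ℝ := f (p.1, T - p.2)

lemma sub_mem_Icc_zero {t : ℝ} (ht : t ∈ Icc 0 T) : T - t ∈ Icc 0 T :=
  ⟨by linarith [ht.2], by linarith [ht.1]⟩

namespace LipschitzPressure

lemma comp_reverse (hP : LipschitzPressure T B L P) : LipschitzPressure T B L (reverse T P) := by
  refine ⟨hP.1, hP.2, fun x t ht => hP.bound x _ (sub_mem_Icc_zero ht), fun x y t ht s hs => ?_⟩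
  have := hP.lip x y _ (sub_mem_Icc_zero ht) _ (sub_mem_Icc_zero hs)
  rwa [sub_sub_sub_cancel_left, abs_sub_comm s t] at this

lemma continuousOn (hP : LipschitzPressure T B L P) : ContinuousOn P (univ ×ˢ Icc 0 T) := by
  have : LipschitzOnWith (2 * L).toNNReal P (univ ×ˢ Icc 0 T) := by
    refine LipschitzOnWith.of_dist_le_mul fun p hp q hq => ?_
    have h := hP.lip p.1 q.1 p.2 hp.2 q.2 hq.2
    rw [Real.coe_toNNReal _ (by linarith [hP.nonneg_lip]), Real.dist_eq]
    have h1 : ‖p.1 - q.1‖ ≤ dist p q := by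
      rw [← dist_eq_norm, Prod.dist_eq]; exact le_max_left _ _
    have h2 : |p.2 - q.2| ≤ dist p q := by
      rw [← Real.dist_eq, Prod.dist_eq]; exact le_max_right _ _
    have := mul_le_mul_of_nonneg_left (add_le_add h1 h2) hP.nonneg_lip
    calc _ ≤ _ := h
      _ ≤ _ := this
      _ = _ := by ring
  exact this.continuousOn

variable {s t : ℝ} {γ : ℝ → Space n}

lemma intervalIntegrable_comp (hP : LipschitzPressure T B L P) (hs : 0 ≤ s) (hst : s ≤ t)
    (ht : t ≤ T) (hγ : Continuous γ) :
    IntervalIntegrable (fun τ => P (γ τ, τ)) volume s t := by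
  apply ContinuousOn.intervalIntegrable
  rw [uIcc_of_le hst]
  exact hP.continuousOn.comp (by fun_prop) fun τ hτ => ⟨mem_univ _, by grind⟩

end LipschitzPressure

variable {s t : ℝ} {γ : ℝ → Space n}

lemma intervalIntegrable_kinetic (hγ : ContDiff ℝ 1 γ) :
    IntervalIntegrable (fun τ => ‖deriv γ τ‖ ^ 2 / 2) volume s t := by
  have := hγ.continuous_deriv le_rfl
  exact Continuous.intervalIntegrable (by fun_prop) _ _

lemma integral_inner_deriv (hγ : ContDiff ℝ 1 γ) (u : Space n) :
    ∫ τ in s..t, inner ℝ u (deriv γ τ) = inner ℝ u (γ t - γ s) := by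
  have hc := hγ.continuous_deriv le_rfl
  rw [intervalIntegral.integral_eq_sub_of_hasDerivAt (f := fun τ => inner ℝ u (γ τ)),
    inner_sub_right]
  · intro τ _
    have h := (hγ.differentiable (by norm_num) τ).hasDerivAt
    simpa using (hasDerivAt_const τ u).inner ℝ h
  · exact Continuous.intervalIntegrable (by fun_prop) _ _

/-- Convexity of the kinetic energy, used as its tangent inequality at the mean velocity `u`. -/
lemma LipschitzPressure.le_orbitAction (hP : LipschitzPressure T B L P) (hs : 0 ≤ s) (hst : s < t)
    (ht : t ≤ T) (hγ : ContDiff ℝ 1 γ) :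
    ‖γ t - γ s‖ ^ 2 / (2 * (t - s)) - B * (t - s) ≤ orbitAction P s t γ := by
  set u : Space n := (t - s)⁻¹ • (γ t - γ s) with hu
  have h0 : 0 < t - s := by linarith
  have hc := hγ.continuous_deriv le_rfl
  have hi1 : IntervalIntegrable (fun τ => inner ℝ u (deriv γ τ)) volume s t :=
    Continuous.intervalIntegrable (by fun_prop) _ _
  have key : ∫ τ in s..t, (inner ℝ u (deriv γ τ) + (-(‖u‖ ^ 2 / 2) - B)) ≤ orbitAction P s t γ := by
    refine intervalIntegral.integral_mono_on hst.le (hi1.add (by simp))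
      ((intervalIntegrable_kinetic hγ).add (hP.intervalIntegrable_comp hs hst.le ht hγ.continuous)) fun τ hτ => ?_
    have h1 := (abs_le.1 (hP.bound (γ τ) τ ⟨by linarith [hτ.1], by linarith [hτ.2]⟩)).1
    have h2 := norm_sub_sq_real u (deriv γ τ)
    nlinarith [sq_nonneg ‖u - deriv γ τ‖]
  rw [intervalIntegral.integral_add hi1 (by simp), integral_inner_deriv hγ] at key
  simp only [intervalIntegral.integral_const, smul_eq_mul] at key
  refine le_trans (le_of_eq ?_) key
  rw [hu, real_inner_smul_left, real_inner_self_eq_norm_sq, norm_smul,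
    Real.norm_of_nonneg (by positivity)]
  field_simp
  ring

/-- Kinetic energy beyond that of the straight orbit pays for the deviation from it. -/
lemma LipschitzPressure.le_orbitAction_of_frozen (hP : LipschitzPressure T B L P) (hs : 0 ≤ s)
    (hst : s < t) (ht : t ≤ T) (hγ : ContDiff ℝ 1 γ) (x₀ : Space n) {t₀ : ℝ} (ht₀ : t₀ ∈ Icc 0 T) :
    ‖γ t - γ s‖ ^ 2 / (2 * (t - s)) + (t - s) * (P (x₀, t₀) -
      L * (‖γ t - x₀‖ + ‖γ s - x₀‖ + |t - t₀| + |s - t₀|)) - L ^ 2 * (t - s) ^ 3 / 2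
      ≤ orbitAction P s t γ := by
  set u : Space n := (t - s)⁻¹ • (γ t - γ s) with hu
  set d := ‖γ t - x₀‖ + ‖γ s - x₀‖ + |t - t₀| + |s - t₀| with hd
  have h0 : 0 < t - s := by linarith
  have hL := hP.nonneg_lip
  have hc := hγ.continuous_deriv le_rfl
  have hi1 : IntervalIntegrable (fun τ => inner ℝ u (deriv γ τ)) volume s t :=
    Continuous.intervalIntegrable (by fun_prop) _ _
  have hi2 : ∀ a b, IntervalIntegrable (fun τ => ‖deriv γ τ - u‖) volume a b := fun a b =>
    Continuous.intervalIntegrable (by fun_prop) _ _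
  set I := ∫ τ in s..t, ‖deriv γ τ - u‖ with hI
  have hdev : ∀ τ ∈ Icc s t, ‖γ τ - γ s - (τ - s) • u‖ ≤ I := by
    intro τ hτ
    have h1 : ∫ σ in s..τ, (deriv γ σ - u) = γ τ - γ s - (τ - s) • u := by
      rw [intervalIntegral.integral_sub (hc.intervalIntegrable _ _) (by simp),
        intervalIntegral.integral_deriv_eq_sub (fun x _ => hγ.differentiable (by norm_num) x)
          (hc.intervalIntegrable _ _)]
      simp
    rw [← h1]
    refine (intervalIntegral.norm_integral_le_integral_norm hτ.1).trans ?_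
    refine intervalIntegral.integral_mono_interval le_rfl hτ.1 hτ.2 ?_ (hi2 s t)
    filter_upwards with σ using norm_nonneg _
  -- The excess `‖γ' - u‖²/2` is at least `L(t-s)‖γ' - u‖ - L²(t-s)²/2`. After integration its
  -- linear part is exactly `L(t-s)I`, which cancels the pressure error caused by the deviation `I`
  -- from the straight orbit.
  have key : ∫ τ in s..t, (inner ℝ u (deriv γ τ) + (L * (t - s) * ‖deriv γ τ - u‖ +
      (-(‖u‖ ^ 2 / 2) - L ^ 2 * (t - s) ^ 2 / 2 + P (x₀, t₀) - L * d - L * I)))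
      ≤ orbitAction P s t γ := by
    refine intervalIntegral.integral_mono_on hst.le (hi1.add (((hi2 s t).const_mul _).add (by simp)))
      ((intervalIntegrable_kinetic hγ).add
      (hP.intervalIntegrable_comp hs hst.le ht hγ.continuous)) fun τ hτ => ?_
    have h1 := (abs_le.1 (hP.lip (γ τ) x₀ τ ⟨by linarith [hτ.1], by linarith [hτ.2]⟩ t₀ ht₀)).1
    have h2 := norm_sub_sq_real (deriv γ τ) u
    rw [real_inner_comm] at h2
    have h3 : ‖γ τ - x₀‖ + |τ - t₀| ≤ d + I := by
      set θ := (τ - s) / (t - s) with hθ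
      have hθ0 : 0 ≤ θ := div_nonneg (by linarith [hτ.1]) h0.le
      have hθ1 : θ ≤ 1 := (div_le_one h0).2 (by linarith [hτ.2])
      have e : γ τ - x₀ = (γ τ - γ s - (τ - s) • u) +
          (θ • (γ t - x₀) + (1 - θ) • (γ s - x₀)) := by
        rw [hu, smul_smul, ← div_eq_mul_inv, ← hθ]; module
      have e2 : ‖γ τ - x₀‖ ≤ I + (‖γ t - x₀‖ + ‖γ s - x₀‖) := by
        rw [e]
        refine (norm_add_le _ _).trans (add_le_add (hdev τ hτ) ((norm_add_le _ _).trans ?_))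
        rw [norm_smul, norm_smul, Real.norm_of_nonneg hθ0, Real.norm_of_nonneg (by linarith)]
        nlinarith [norm_nonneg (γ t - x₀), norm_nonneg (γ s - x₀)]
      have e3 : |τ - t₀| ≤ |t - t₀| + |s - t₀| := by
        rw [abs_le]
        constructor <;> linarith [hτ.1, hτ.2, neg_abs_le (s - t₀), le_abs_self (t - t₀),
          abs_nonneg (s - t₀), abs_nonneg (t - t₀)]
      linarith
    have h4 := mul_le_mul_of_nonneg_left h3 hL
    nlinarith [sq_nonneg (‖deriv γ τ - u‖ - L * (t - s))]
  rw [intervalIntegral.integral_add hi1 (((hi2 s t).const_mul _).add (by simp)),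
    integral_inner_deriv hγ, intervalIntegral.integral_add ((hi2 s t).const_mul _) (by simp),
    intervalIntegral.integral_const_mul, ← hI] at key
  simp only [intervalIntegral.integral_const, smul_eq_mul] at key
  refine le_trans (le_of_eq ?_) key
  rw [hu, real_inner_smul_left, real_inner_self_eq_norm_sq, norm_smul,
    Real.norm_of_nonneg (by positivity)]
  field_simp
  ring

/-- The straight orbit from `y` at time `s` to `x` at time `t`. -/
def line (y x : Space n) (s t τ : ℝ) : Space n := y + ((τ - s) / (t - s)) • (x - y)

lemma contDiff_line (y x : Space n) (s t : ℝ) : ContDiff ℝ 1 (line y x s t) := by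
  unfold line; fun_prop

@[simp] lemma line_left (y x : Space n) (s t : ℝ) : line y x s t s = y := by simp [line]

lemma line_right (y x : Space n) {s t : ℝ} (h : s < t) : line y x s t t = x := by
  have : t - s ≠ 0 := by linarith
  simp [line, this]

lemma deriv_line (y x : Space n) (s t τ : ℝ) : deriv (line y x s t) τ = (t - s)⁻¹ • (x - y) := by
  have h : HasDerivAt (fun τ : ℝ => (τ - s) / (t - s)) (t - s)⁻¹ τ := by
    simpa using ((hasDerivAt_id τ).sub_const s).div_const (t - s)
  exact ((h.smul_const (x - y)).const_add y).deriv

lemma LipschitzPressure.orbitAction_line_le (hP : LipschitzPressure T B L P) (hs : 0 ≤ s)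
    (hst : s < t) (ht : t ≤ T) (y x : Space n) {A : ℝ}
    (hA : ∀ τ ∈ Icc s t, P (line y x s t τ, τ) ≤ A) :
    orbitAction P s t (line y x s t) ≤ ‖x - y‖ ^ 2 / (2 * (t - s)) + (t - s) * A := by
  have h0 : 0 < t - s := by linarith
  have key : orbitAction P s t (line y x s t) ≤
      ∫ _τ in s..t, (‖x - y‖ ^ 2 / (2 * (t - s) ^ 2) + A) := by
    refine intervalIntegral.integral_mono_on hst.le
      ((intervalIntegrable_kinetic (contDiff_line ..)).add
      (hP.intervalIntegrable_comp hs hst.le ht (contDiff_line ..).continuous)) (by simp)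
      fun τ hτ => ?_
    rw [deriv_line, norm_smul, Real.norm_of_nonneg (by positivity)]
    refine add_le_add (le_of_eq ?_) (hA τ hτ)
    field_simp
  refine key.trans (le_of_eq ?_)
  simp only [intervalIntegral.integral_const, smul_eq_mul]
  field_simp

lemma LipschitzPressure.orbitAction_line_le_bound (hP : LipschitzPressure T B L P) (hs : 0 ≤ s)
    (hst : s < t) (ht : t ≤ T) (y x : Space n) :
    orbitAction P s t (line y x s t) ≤ ‖x - y‖ ^ 2 / (2 * (t - s)) + (t - s) * B :=
  hP.orbitAction_line_le hs hst ht y x fun τ hτ =>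
    (abs_le.1 (hP.bound _ τ ⟨by linarith [hτ.1], by linarith [hτ.2]⟩)).2

lemma LipschitzPressure.orbitAction_line_le_frozen (hP : LipschitzPressure T B L P) (hs : 0 ≤ s)
    (hst : s < t) (ht : t ≤ T) (y x x₀ : Space n) {t₀ : ℝ} (ht₀ : t₀ ∈ Icc 0 T) :
    orbitAction P s t (line y x s t) ≤ ‖x - y‖ ^ 2 / (2 * (t - s)) + (t - s) * (P (x₀, t₀) +
      L * (‖x - x₀‖ + ‖y - x₀‖ + |t - t₀| + |s - t₀|)) := by
  have h0 : 0 < t - s := by linarith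
  refine hP.orbitAction_line_le hs hst ht y x fun τ hτ => ?_
  have h1 := (abs_le.1 (hP.lip (line y x s t τ) x₀ τ
    ⟨by linarith [hτ.1], by linarith [hτ.2]⟩ t₀ ht₀)).2
  set θ := (τ - s) / (t - s) with hθ
  have hθ0 : 0 ≤ θ := div_nonneg (by linarith [hτ.1]) h0.le
  have hθ1 : θ ≤ 1 := (div_le_one h0).2 (by linarith [hτ.2])
  have e : line y x s t τ - x₀ = θ • (x - x₀) + (1 - θ) • (y - x₀) := by
    rw [line, ← hθ]; module
  have e2 : ‖line y x s t τ - x₀‖ ≤ ‖x - x₀‖ + ‖y - x₀‖ := by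
    rw [e]
    refine (norm_add_le _ _).trans ?_
    rw [norm_smul, norm_smul, Real.norm_of_nonneg hθ0, Real.norm_of_nonneg (by linarith)]
    nlinarith [norm_nonneg (x - x₀), norm_nonneg (y - x₀)]
  have e3 : |τ - t₀| ≤ |t - t₀| + |s - t₀| := by
    rw [abs_le]
    constructor <;> linarith [hτ.1, hτ.2, neg_abs_le (s - t₀), le_abs_self (t - t₀),
      abs_nonneg (s - t₀), abs_nonneg (t - t₀)]
  have h4 := mul_le_mul_of_nonneg_left (add_le_add e2 e3) hP.nonneg_lip
  linarith

/-- The orbit `γ` with its value at time `t` displaced by `ξ` and its value at time `s` kept. -/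
def displace (γ : ℝ → Space n) (s t : ℝ) (ξ : Space n) (τ : ℝ) : Space n :=
  γ τ + ((τ - s) / (t - s)) • ξ

lemma contDiff_displace (hγ : ContDiff ℝ 1 γ) (ξ : Space n) :
    ContDiff ℝ 1 (displace γ s t ξ) := by
  unfold displace; fun_prop

@[simp] lemma displace_left (ξ : Space n) : displace γ s t ξ s = γ s := by simp [displace]

lemma displace_right (h : s < t) (ξ : Space n) : displace γ s t ξ t = γ t + ξ := by
  have : t - s ≠ 0 := by linarith
  simp [displace, this]

lemma deriv_displace (hγ : ContDiff ℝ 1 γ) (ξ : Space n) (τ : ℝ) :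
    deriv (displace γ s t ξ) τ = deriv γ τ + (t - s)⁻¹ • ξ := by
  have h : HasDerivAt (fun τ : ℝ => (τ - s) / (t - s)) (t - s)⁻¹ τ := by
    simpa using ((hasDerivAt_id τ).sub_const s).div_const (t - s)
  exact ((hγ.differentiable (by norm_num) τ).hasDerivAt.add (h.smul_const ξ)).deriv

/-- The displacement has constant velocity, so the kinetic cross term depends only on the endpoints
of `γ`. All nonlinearity in the pressure stays in the last integral. -/
lemma LipschitzPressure.orbitAction_displace (hP : LipschitzPressure T B L P) (hs : 0 ≤ s)
    (hst : s < t) (ht : t ≤ T) (hγ : ContDiff ℝ 1 γ) (ξ : Space n) :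
    orbitAction P s t (displace γ s t ξ) = orbitAction P s t γ +
      inner ℝ ((t - s)⁻¹ • (γ t - γ s)) ξ + ‖ξ‖ ^ 2 / (2 * (t - s)) +
      ∫ τ in s..t, (P (displace γ s t ξ τ, τ) - P (γ τ, τ)) := by
  have h0 : 0 < t - s := by linarith
  have hc := hγ.continuous_deriv le_rfl
  have hi1 := hP.intervalIntegrable_comp hs hst.le ht hγ.continuous
  have hi2 := hP.intervalIntegrable_comp hs hst.le ht
    (contDiff_displace (s := s) (t := t) hγ ξ).continuous
  have hi3 : IntervalIntegrable (fun τ => inner ℝ ((t - s)⁻¹ • ξ) (deriv γ τ)) volume s t :=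
    Continuous.intervalIntegrable (by fun_prop) _ _
  have e : ∀ τ, ‖deriv (displace γ s t ξ) τ‖ ^ 2 / 2 + P (displace γ s t ξ τ, τ) =
      ((‖deriv γ τ‖ ^ 2 / 2 + P (γ τ, τ)) + (inner ℝ ((t - s)⁻¹ • ξ) (deriv γ τ) +
      ‖ξ‖ ^ 2 / (2 * (t - s) ^ 2))) + (P (displace γ s t ξ τ, τ) - P (γ τ, τ)) := by
    intro τ
    rw [deriv_displace hγ, norm_add_sq_real, real_inner_comm, norm_smul,
      Real.norm_of_nonneg (by positivity)]
    field_simp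
    ring
  unfold orbitAction
  simp_rw [e]
  rw [intervalIntegral.integral_add (((intervalIntegrable_kinetic hγ).add hi1).add
    (hi3.add (by simp))) (hi2.sub hi1), intervalIntegral.integral_add
    ((intervalIntegrable_kinetic hγ).add hi1) (hi3.add (by simp)),
    intervalIntegral.integral_add hi3 (by simp), integral_inner_deriv hγ]
  simp only [intervalIntegral.integral_const, smul_eq_mul]
  rw [real_inner_smul_left, real_inner_smul_left, real_inner_comm ξ]
  field_simp
  ring

end

/-! ### A priori bounds and first-order upper estimates for forward solutions -/

section

variable {n : ℕ} {T B L : ℝ} {P φ : Space n × ℝ → ℝ}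
variable {s t : ℝ} {γ : ℝ → Space n}

/-- Real `sInf` takes a default value on sets unbounded below; this makes `minimalAction` a genuine
infimum. -/
lemma LipschitzPressure.bddBelow_actions (hP : LipschitzPressure T B L P) (hs : 0 ≤ s)
    (hst : s < t) (ht : t ≤ T) (y x : Space n) :
    BddBelow {A : ℝ | ∃ γ : ℝ → Space n,
      ContDiff ℝ 1 γ ∧ γ s = y ∧ γ t = x ∧ A = orbitAction P s t γ} := by
  refine ⟨-(B * (t - s)), ?_⟩
  rintro A ⟨γ, hγ, -, -, rfl⟩
  have h := hP.le_orbitAction hs hst ht hγ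
  have : 0 ≤ ‖γ t - γ s‖ ^ 2 / (2 * (t - s)) := div_nonneg (sq_nonneg _) (by linarith)
  linarith

namespace IsForwardSolution

lemma le_add_orbitAction (hφ : IsForwardSolution T P φ) (hP : LipschitzPressure T B L P)
    (hs : 0 ≤ s) (hst : s < t) (ht : t ≤ T) (hγ : ContDiff ℝ 1 γ) :
    φ (γ t, t) ≤ φ (γ s, s) + orbitAction P s t γ := by
  have h1 := (hφ.isGLB (γ t) s ⟨hs, by linarith⟩ t ⟨by linarith, ht⟩ hst).1 ⟨γ s, rfl⟩
  have h2 : minimalAction P (γ s) (γ t) s t ≤ orbitAction P s t γ :=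
    csInf_le (hP.bddBelow_actions hs hst ht _ _) ⟨γ, hγ, rfl, rfl, rfl⟩
  dsimp at h1
  linarith

lemma exists_orbit (hφ : IsForwardSolution T P φ) (hs : 0 ≤ s) (hst : s < t) (ht : t ≤ T)
    (x : Space n) {ε : ℝ} (hε : 0 < ε) :
    ∃ γ : ℝ → Space n, ContDiff ℝ 1 γ ∧ γ t = x ∧
      φ (γ s, s) + orbitAction P s t γ < φ (x, t) + ε := by
  have h1 := hφ.isGLB x s ⟨hs, by linarith⟩ t ⟨by linarith, ht⟩ hst
  obtain ⟨_, ⟨y, rfl⟩, -, hy⟩ := h1.exists_between (show φ (x, t) < φ (x, t) + ε / 2 by linarith)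
  dsimp at hy
  have hne : {A : ℝ | ∃ γ : ℝ → Space n,
      ContDiff ℝ 1 γ ∧ γ s = y ∧ γ t = x ∧ A = orbitAction P s t γ}.Nonempty :=
    ⟨_, line y x s t, contDiff_line .., line_left .., line_right _ _ hst, rfl⟩
  obtain ⟨_, ⟨γ, hγ, hγs, hγt, rfl⟩, hlt⟩ := exists_lt_of_csInf_lt hne
    (show minimalAction P y x s t < minimalAction P y x s t + ε / 2 by linarith)
  exact ⟨γ, hγ, hγt, by rw [hγs]; linarith⟩

/-- At time 0 the bound comes from the finite value `φ (0, T)`: every initial point, translated into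
a bounded cell, reaches the origin at time `T` at bounded cost. Later times cost at least `-B * T`
more. -/
lemma bddBelow (hφ : IsForwardSolution T P φ) (hP : LipschitzPressure T B L P) (hT : 0 < T) :
    ∃ m, ∀ x, ∀ t ∈ Icc 0 T, m ≤ φ (x, t) := by
  have h0 : ∃ m, ∀ x, m ≤ φ (x, 0) := by
    refine ⟨φ (0, T) - (√n ^ 2 / (2 * (T - 0)) + (T - 0) * B), fun x => ?_⟩
    obtain ⟨z, hz⟩ := exists_latticeVector_norm_le x
    rw [← hφ.periodic z x 0 ⟨le_rfl, hT.le⟩]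
    have h1 := hφ.le_add_orbitAction hP le_rfl hT le_rfl
      (contDiff_line (x + latticeVector z) 0 0 T)
    rw [line_left, line_right _ _ hT] at h1
    have h2 := hP.orbitAction_line_le_bound le_rfl hT le_rfl (x + latticeVector z) 0
    have h3 : ‖0 - (x + latticeVector z)‖ ^ 2 / (2 * (T - 0)) ≤ √n ^ 2 / (2 * (T - 0)) := by
      rw [zero_sub, norm_neg]
      have : 0 < T - 0 := by linarith
      gcongr
    linarith
  obtain ⟨m, hm⟩ := h0
  refine ⟨m - B * T, fun x t ht => ?_⟩
  have hBT : 0 ≤ B * T := mul_nonneg hP.nonneg_bound hT.le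
  rcases ht.1.eq_or_lt with h | h
  · subst h; linarith [hm x]
  refine le_of_forall_pos_le_add fun ε hε => ?_
  obtain ⟨γ, hγ, -, hlt⟩ := hφ.exists_orbit le_rfl h ht.2 x hε
  have h1 := hP.le_orbitAction le_rfl h ht.2 hγ
  have : 0 ≤ ‖γ t - γ 0‖ ^ 2 / (2 * (t - 0)) := div_nonneg (sq_nonneg _) (by linarith)
  have : B * (t - 0) ≤ B * T := mul_le_mul_of_nonneg_left (by linarith [ht.2]) hP.nonneg_bound
  linarith [hm (γ 0)]

/-- Any cell point is reached from the origin at time 0 with kinetic cost at most `n / (2t)`, hence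
the restriction to `t ≥ a`. -/
lemma bddAbove (hφ : IsForwardSolution T P φ) (hP : LipschitzPressure T B L P) {a : ℝ}
    (ha : 0 < a) : ∃ m, ∀ x, ∀ t ∈ Icc a T, φ (x, t) ≤ m := by
  refine ⟨φ (0, 0) + (√n ^ 2 / (2 * a) + T * B), fun x t ht => ?_⟩
  have ht0 : 0 < t := by linarith [ht.1]
  obtain ⟨z, hz⟩ := exists_latticeVector_norm_le x
  rw [← hφ.periodic z x t ⟨ht0.le, ht.2⟩]
  have h1 := hφ.le_add_orbitAction hP le_rfl ht0 ht.2 (contDiff_line 0 (x + latticeVector z) 0 t)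
  rw [line_left, line_right _ _ ht0] at h1
  have h2 := hP.orbitAction_line_le_bound le_rfl ht0 ht.2 0 (x + latticeVector z)
  have h3 : ‖x + latticeVector z - 0‖ ^ 2 / (2 * (t - 0)) ≤ √n ^ 2 / (2 * a) := by
    rw [sub_zero, sub_zero]
    have := ht.1
    gcongr
  have h4 : (t - 0) * B ≤ T * B := mul_le_mul_of_nonneg_right (by linarith [ht.2]) hP.nonneg_bound
  linarith

/-- A near-optimal orbit to `x'`, displaced to end at `x`, competes for `x`. Its mean velocity is
controlled because the bounds on `φ` limit its kinetic energy. For `‖x - x'‖ ≥ 1` the oscillation of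
`φ` is enough. -/
lemma exists_lipschitz (hφ : IsForwardSolution T P φ) (hP : LipschitzPressure T B L P)
    (hT : 0 < T) {a : ℝ} (ha : 0 < a) :
    ∃ R, 0 ≤ R ∧ ∀ x x', ∀ t ∈ Icc a T, φ (x, t) - φ (x', t) ≤ R * ‖x - x'‖ := by
  obtain ⟨m, hm⟩ := hφ.bddBelow hP hT
  obtain ⟨M, hM⟩ := hφ.bddAbove hP ha
  set D := |M - m| with hD
  have hD0 : 0 ≤ D := abs_nonneg _
  have hDle : M - m ≤ D := le_abs_self _
  set Q := 2 * T * (D + 1 + B * T) with hQ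
  have hB := hP.nonneg_bound
  have hL := hP.nonneg_lip
  have hQ0 : 0 ≤ Q := by positivity
  refine ⟨D + (√Q / a + 1 / (2 * a) + L * T), by positivity, fun x x' t ht => ?_⟩
  have ht0 : 0 < t := by linarith [ht.1]
  rcases le_total 1 ‖x - x'‖ with h | h
  · have h1 := hM x t ht
    have h2 := hm x' t ⟨ht0.le, ht.2⟩
    have : 0 ≤ √Q / a + 1 / (2 * a) + L * T := by positivity
    nlinarith
  refine le_of_forall_pos_lt_add fun ε hε => ?_
  set ξ := x - x' with hξ
  -- The tolerance 1 keeps the velocity bound independent of `ε`.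
  obtain ⟨γ, hγ, hγt, hlt⟩ := hφ.exists_orbit le_rfl ht0 ht.2 x' (lt_min hε one_pos)
  have hup := hφ.le_add_orbitAction hP le_rfl ht0 ht.2 (contDiff_displace (s := 0) (t := t) hγ ξ)
  rw [displace_left, displace_right ht0, hγt, hξ, add_sub_cancel, ← hξ,
    hP.orbitAction_displace le_rfl ht0 ht.2 hγ, hγt] at hup
  have hlow := hP.le_orbitAction le_rfl ht0 ht.2 hγ
  rw [hγt] at hlow
  have hu : ‖(t - 0)⁻¹ • (x' - γ 0)‖ ≤ √Q / a := by
    rw [norm_smul, sub_zero, Real.norm_of_nonneg (by positivity), inv_mul_eq_div]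
    have h1 : ‖x' - γ 0‖ ≤ √Q := by
      apply Real.le_sqrt_of_sq_le
      have h2 := hm (γ 0) 0 ⟨le_rfl, hT.le⟩
      have h3 := hM x' t ht
      have h4 : B * (t - 0) ≤ B * T := mul_le_mul_of_nonneg_left (by linarith [ht.2]) hB
      have h5 : ‖x' - γ 0‖ ^ 2 / (2 * (t - 0)) ≤ D + 1 + B * T := by
        linarith [min_le_right ε 1]
      rw [div_le_iff₀ (by linarith)] at h5
      refine h5.trans ?_
      rw [hQ, sub_zero, mul_comm]
      gcongr
      exact ht.2
    have := ht.1
    gcongr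
  have hin : inner ℝ ((t - 0)⁻¹ • (x' - γ 0)) ξ ≤ √Q / a * ‖ξ‖ :=
    (real_inner_le_norm _ _).trans (mul_le_mul_of_nonneg_right hu (norm_nonneg _))
  have hsq : ‖ξ‖ ^ 2 / (2 * (t - 0)) ≤ 1 / (2 * a) * ‖ξ‖ := by
    rw [sub_zero, div_mul_eq_mul_div]
    have := ht.1
    gcongr
    nlinarith [norm_nonneg ξ]
  have hint : ∫ τ in (0 : ℝ)..t, (P (displace γ 0 t ξ τ, τ) - P (γ τ, τ)) ≤ L * T * ‖ξ‖ := by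
    have h1 : ∫ τ in (0 : ℝ)..t, (P (displace γ 0 t ξ τ, τ) - P (γ τ, τ)) ≤
        ∫ _τ in (0 : ℝ)..t, L * ‖ξ‖ := by
      refine intervalIntegral.integral_mono_on ht0.le
        ((hP.intervalIntegrable_comp le_rfl ht0.le ht.2 (contDiff_displace hγ ξ).continuous).sub
        (hP.intervalIntegrable_comp le_rfl ht0.le ht.2 hγ.continuous)) (by simp) fun τ hτ => ?_
      have hτ' : τ ∈ Icc 0 T := ⟨hτ.1, hτ.2.trans ht.2⟩
      have h2 := (abs_le.1 (hP.lip (displace γ 0 t ξ τ) (γ τ) τ hτ' τ hτ')).2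
      refine h2.trans ?_
      simp only [displace, add_sub_cancel_left, sub_self, abs_zero, add_zero, sub_zero, norm_smul]
      refine mul_le_mul_of_nonneg_left (mul_le_of_le_one_left (norm_nonneg _) ?_) hL
      rw [Real.norm_of_nonneg (div_nonneg hτ.1 ht0.le)]
      exact (div_le_one ht0).2 hτ.2
    refine h1.trans ?_
    simp only [intervalIntegral.integral_const, smul_eq_mul, sub_zero]
    have : t * (L * ‖ξ‖) ≤ T * (L * ‖ξ‖) :=
      mul_le_mul_of_nonneg_right ht.2 (mul_nonneg hL (norm_nonneg _))
    linarith
  have := mul_nonneg hD0 (norm_nonneg ξ)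
  have := min_le_left ε 1
  nlinarith

/-- Comparison with the orbit at rest at `x₀`: the spatial Lipschitz bound limits the gain from
moving to `R * δ * ‖u‖`, against a kinetic cost `δ * ‖u‖² / 2`. Thus `‖u‖` is bounded uniformly in
`δ`. -/
lemma exists_orbit_speed_le (hφ : IsForwardSolution T P φ) (hP : LipschitzPressure T B L P)
    (hT : 0 < T) {t₀ : ℝ} (ht₀ : t₀ ∈ Ioo 0 T) (x₀ : Space n) :
    ∃ R : ℝ, 0 ≤ R ∧ ∀ δ, 0 < δ → δ ≤ t₀ / 2 → δ ≤ 1 → ∃ γ : ℝ → Space n, ContDiff ℝ 1 γ ∧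
      γ t₀ = x₀ ∧ φ (γ (t₀ - δ), t₀ - δ) + orbitAction P (t₀ - δ) t₀ γ < φ (x₀, t₀) + δ ^ 2 ∧
      ‖δ⁻¹ • (x₀ - γ (t₀ - δ))‖ ≤ R := by
  have hB := hP.nonneg_bound
  obtain ⟨R, hR0, hR⟩ := hφ.exists_lipschitz hP hT (half_pos ht₀.1)
  refine ⟨2 * R + 2 * (2 * B + 1) + 1, by positivity, fun δ hδ hδ1 hδ3 => ?_⟩
  set s := t₀ - δ with hs
  have hs0 : 0 ≤ s := by linarith [ht₀.1]
  have hst : s < t₀ := by linarith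
  have hsd : t₀ - s = δ := by rw [hs]; ring
  obtain ⟨γ, hγ, hγt, hlt⟩ := hφ.exists_orbit hs0 hst ht₀.2.le x₀ (sq_pos_of_pos hδ)
  refine ⟨γ, hγ, hγt, hlt, ?_⟩
  set y := γ s with hy
  set u := δ⁻¹ • (x₀ - y) with hu
  have hxy : x₀ - y = δ • u := by rw [hu, smul_smul, mul_inv_cancel₀ hδ.ne', one_smul]
  have hnxy : ‖x₀ - y‖ = δ * ‖u‖ := by rw [hxy, norm_smul, Real.norm_of_nonneg hδ.le]
  have h1 := hP.le_orbitAction hs0 hst ht₀.2.le hγ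
  rw [hγt, hsd, ← hy, hnxy] at h1
  have h2 := hφ.le_add_orbitAction hP hs0 hst ht₀.2.le (contDiff_line x₀ x₀ s t₀)
  rw [line_left, line_right _ _ hst] at h2
  have h3 := hP.orbitAction_line_le_bound hs0 hst ht₀.2.le x₀ x₀
  rw [sub_self, norm_zero, hsd] at h3
  have h4 := hR x₀ y s ⟨by linarith, by linarith [ht₀.2]⟩
  rw [hnxy] at h4
  have h5 : (δ * ‖u‖) ^ 2 / (2 * δ) = δ * (‖u‖ ^ 2 / 2) := by field_simp
  have h6 : δ * (‖u‖ ^ 2 / 2) ≤ δ * (R * ‖u‖ + 2 * B + 1) := by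
    rw [← h5]
    norm_num at h3
    nlinarith
  have h7 := le_of_mul_le_mul_left h6 hδ
  by_contra! hcon
  have : 0 ≤ ‖u‖ := norm_nonneg u
  nlinarith

/-- First-order upper estimate of a forward solution at scale `δ`, with an error that is quadratic
in the displacement up to a remainder of order `δ²`. -/
lemma exists_upper_estimate (hφ : IsForwardSolution T P φ) (hP : LipschitzPressure T B L P)
    (hT : 0 < T) {t₀ : ℝ} (ht₀ : t₀ ∈ Ioo 0 T) (x₀ : Space n) :
    ∃ C ρ : ℝ, 0 ≤ C ∧ 0 < ρ ∧ ∀ δ, 0 < δ → δ ≤ ρ → ∃ u : Space n, ∀ ξ τ, ‖ξ‖ ≤ δ / 2 →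
      |τ| ≤ δ / 2 → φ (x₀ + ξ, t₀ + τ) ≤ φ (x₀, t₀) + inner ℝ u ξ + (P (x₀, t₀) - ‖u‖ ^ 2 / 2) * τ +
        C * ((max ‖ξ‖ |τ|) ^ 2 / δ + δ ^ 2) := by
  have hL := hP.nonneg_lip
  have ht₀' : t₀ ∈ Icc 0 T := ⟨ht₀.1.le, ht₀.2.le⟩
  obtain ⟨R', hR'0, hR⟩ := hφ.exists_orbit_speed_le hP hT ht₀ x₀
  refine ⟨(1 + R') ^ 2 + L * (2 * R' + 5) * 3 + L ^ 2 + 1, min (min (t₀ / 2) (T - t₀)) 1,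
    by positivity, lt_min (lt_min (half_pos ht₀.1) (sub_pos.2 ht₀.2)) one_pos, fun δ hδ hδρ => ?_⟩
  have hδ1 : δ ≤ t₀ / 2 := hδρ.trans ((min_le_left _ _).trans (min_le_left _ _))
  have hδ2 : δ ≤ T - t₀ := hδρ.trans ((min_le_left _ _).trans (min_le_right _ _))
  have hδ3 : δ ≤ 1 := hδρ.trans (min_le_right _ _)
  obtain ⟨γ, hγ, hγt, hlt, huR⟩ := hR δ hδ hδ1 hδ3
  set s := t₀ - δ with hs
  have hs0 : 0 ≤ s := by linarith [ht₀.1]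
  have hst : s < t₀ := by linarith
  have hsd : t₀ - s = δ := by rw [hs]; ring
  set y := γ s with hy
  set u := δ⁻¹ • (x₀ - y) with hu
  have hxy : x₀ - y = δ • u := by rw [hu, smul_smul, mul_inv_cancel₀ hδ.ne', one_smul]
  have hnxy : ‖x₀ - y‖ = δ * ‖u‖ := by rw [hxy, norm_smul, Real.norm_of_nonneg hδ.le]
  refine ⟨u, fun ξ τ hξ hτ => ?_⟩
  have hτ' := abs_le.1 hτ
  have hst' : s < t₀ + τ := by linarith
  have hT' : t₀ + τ ≤ T := by linarith
  have hd : t₀ + τ - s = δ + τ := by rw [hs]; ring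
  have hd0 : 0 < δ + τ := by linarith
  have hlow := hP.le_orbitAction_of_frozen hs0 hst ht₀.2.le hγ x₀ ht₀'
  rw [hγt, hsd, ← hy, hnxy, sub_self, sub_self, norm_zero, abs_zero, norm_sub_rev y x₀, hnxy,
    abs_sub_comm s, hsd, abs_of_pos hδ] at hlow
  have hup := hφ.le_add_orbitAction hP hs0 hst' hT' (contDiff_line y (x₀ + ξ) s (t₀ + τ))
  rw [line_left, line_right _ _ hst'] at hup
  have hup2 := hP.orbitAction_line_le_frozen hs0 hst' hT' y (x₀ + ξ) x₀ ht₀'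
  rw [hd, add_sub_cancel_left, add_sub_cancel_left, norm_sub_rev y x₀, hnxy,
    abs_sub_comm s, hsd, abs_of_pos hδ] at hup2
  -- Exact expansion of the free kinetic cost about the motion with velocity `u`; only the last term
  -- is not affine in `(ξ, τ)`.
  have hsq : ‖x₀ + ξ - y‖ ^ 2 / (2 * (δ + τ)) = (δ * ‖u‖) ^ 2 / (2 * δ) + inner ℝ u ξ
      - ‖u‖ ^ 2 / 2 * τ + ‖ξ - τ • u‖ ^ 2 / (2 * (δ + τ)) := by
    have e : x₀ + ξ - y = (δ + τ) • u + (ξ - τ • u) := by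
      rw [add_sub_right_comm, hxy]; module
    rw [e, norm_add_sq_real, norm_smul, Real.norm_of_nonneg hd0.le, real_inner_smul_left,
      inner_sub_right, real_inner_smul_right, real_inner_self_eq_norm_sq]
    field_simp
    ring
  set r := max ‖ξ‖ |τ| with hr
  have hr0 : 0 ≤ r := (norm_nonneg _).trans (le_max_left _ _)
  have hξr : ‖ξ‖ ≤ r := le_max_left _ _
  have hτr : |τ| ≤ r := le_max_right _ _
  have hrem : ‖ξ - τ • u‖ ^ 2 / (2 * (δ + τ)) ≤ (1 + R') ^ 2 * (r ^ 2 / δ) := by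
    have h1 : ‖ξ - τ • u‖ ≤ (1 + R') * r := by
      refine (norm_sub_le _ _).trans ?_
      rw [norm_smul, Real.norm_eq_abs]
      linarith [mul_le_mul hτr huR (norm_nonneg _) hr0]
    have h2 : δ ≤ 2 * (δ + τ) := by linarith
    calc _ ≤ ((1 + R') * r) ^ 2 / δ := by gcongr
      _ = _ := by ring
  have huδ : δ * ‖u‖ ≤ δ * R' := mul_le_mul_of_nonneg_left huR hδ.le
  have he1 : (δ + τ) * (L * (‖ξ‖ + δ * ‖u‖ + |τ| + δ)) ≤ L * (R' + 3) * 2 * δ ^ 2 := by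
    calc _ ≤ (2 * δ) * (L * (δ + δ * R' + δ + δ)) := by
          have : δ + τ ≤ 2 * δ := by linarith
          have : ‖ξ‖ ≤ δ := by linarith
          have : |τ| ≤ δ := by linarith
          gcongr
      _ = _ := by ring
  have he2 : δ * (L * (δ * ‖u‖ + δ)) ≤ L * (R' + 1) * δ ^ 2 := by
    calc _ ≤ δ * (L * (δ * R' + δ)) := by gcongr
      _ = _ := by ring
  have he3 : L ^ 2 * δ ^ 3 / 2 ≤ L ^ 2 * δ ^ 2 := by
    have : L ^ 2 * δ ^ 2 * δ ≤ L ^ 2 * δ ^ 2 * 1 := by gcongr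
    have h0 : 0 ≤ L ^ 2 * δ ^ 2 := by positivity
    calc L ^ 2 * δ ^ 3 / 2 = L ^ 2 * δ ^ 2 * δ / 2 := by ring
      _ ≤ _ := by linarith
  have hrδ : 0 ≤ r ^ 2 / δ := by positivity
  have hfin : (1 + R') ^ 2 * (r ^ 2 / δ) + L * (R' + 3) * 2 * δ ^ 2 + L * (R' + 1) * δ ^ 2
      + L ^ 2 * δ ^ 2 + δ ^ 2 ≤
      ((1 + R') ^ 2 + L * (2 * R' + 5) * 3 + L ^ 2 + 1) * (r ^ 2 / δ + δ ^ 2) := by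
    have a1 : 0 ≤ (L * (2 * R' + 5) * 3 + L ^ 2 + 1) * (r ^ 2 / δ) := by positivity
    have a2 : 0 ≤ ((1 + R') ^ 2 + 3 * L * R' + 8 * L) * δ ^ 2 := by positivity
    refine (le_add_of_nonneg_right (add_nonneg a1 a2)).trans (le_of_eq ?_)
    ring
  simp only [zero_add, add_zero] at hlow
  linarith

end IsForwardSolution

end

section

/-! ### Differentiability from one-sided estimates at all scales -/

section Squeeze

variable {X : Type*} [NormedAddCommGroup X] [NormedSpace ℝ X] {f g : X → ℝ} {x₀ : X} {C ρ : ℝ}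

/-- With `δ ~ a²`, the test radius `r ~ a³` balances `r² / δ` against `δ²`: both are `O(a⁴)`, and
division by `r` leaves `O(a)`. The factor 4 in the windows admits two consecutive scales with the
same `a`. -/
lemma dist_le_of_squeeze (hρ : 0 < ρ) (hρ1 : ρ ≤ 1) (hC : 0 ≤ C) (heq : f x₀ = g x₀)
    (hle : ∀ z, ‖z‖ ≤ ρ → g (x₀ + z) ≤ f (x₀ + z)) {a δ δ' : ℝ} (ha : 0 < a) (ha1 : a ≤ 1)
    (hδ : δ ∈ Icc (ρ * a ^ 2 / 4) (ρ * a ^ 2)) (hδ' : δ' ∈ Icc (ρ * a ^ 2 / 4) (ρ * a ^ 2))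
    {ℓ ℓ' : X →L[ℝ] ℝ}
    (hf : ∀ z, ‖z‖ ≤ δ / 2 → f (x₀ + z) ≤ f x₀ + ℓ z + C * (‖z‖ ^ 2 / δ + δ ^ 2))
    (hg : ∀ z, ‖z‖ ≤ δ' / 2 → g x₀ + ℓ' z - C * (‖z‖ ^ 2 / δ' + δ' ^ 2) ≤ g (x₀ + z)) :
    dist ℓ ℓ' ≤ 32 * C * a := by
  have ha3 : a ^ 3 ≤ a ^ 2 := pow_le_pow_of_le_one ha.le ha1 (by norm_num)
  have ha2 : a ^ 2 ≤ 1 := pow_le_one₀ ha.le ha1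
  set r := ρ * a ^ 3 / 8 with hr
  have hr0 : 0 < r := by positivity
  have hr1 : r ≤ ρ * a ^ 2 / 4 / 2 := by
    have := mul_le_mul_of_nonneg_left ha3 hρ.le
    rw [hr]; linarith
  have hrρ : r ≤ ρ := by nlinarith
  have herr : ∀ d ∈ Icc (ρ * a ^ 2 / 4) (ρ * a ^ 2), C * (r ^ 2 / d + d ^ 2) ≤
      C * (2 * ρ * a ^ 4) := by
    intro d hd
    have hd0 : 0 < d := lt_of_lt_of_le (by positivity) hd.1
    have h1 : r ^ 2 / d ≤ ρ * a ^ 4 := by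
      rw [div_le_iff₀ hd0]
      calc r ^ 2 = ρ * a ^ 4 * (ρ * a ^ 2 / 64) := by rw [hr]; ring
        _ ≤ ρ * a ^ 4 * d := by
          have : 0 < ρ * a ^ 2 := by positivity
          gcongr; linarith [hd.1]
    have h2 : d ^ 2 ≤ ρ * a ^ 4 := by
      calc d ^ 2 ≤ (ρ * a ^ 2) ^ 2 := by gcongr; exact hd.2
        _ = ρ * (ρ * a ^ 4) := by ring
        _ ≤ 1 * (ρ * a ^ 4) := by gcongr
        _ = _ := one_mul _
    gcongr; linarith
  have key : ∀ x : X, ‖x‖ = 1 → (ℓ' - ℓ) x ≤ 32 * C * a := by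
    intro x hx
    have hz : ‖r • x‖ = r := by rw [norm_smul, hx, mul_one, Real.norm_of_nonneg hr0.le]
    have h1 := hf (r • x) (by rw [hz]; linarith [hδ.1])
    have h2 := hg (r • x) (by rw [hz]; linarith [hδ'.1])
    have h3 := hle (r • x) (by rw [hz]; exact hrρ)
    rw [hz] at h1 h2
    have h4 : r * (ℓ' - ℓ) x ≤ r * (32 * C * a) := by
      calc r * (ℓ' - ℓ) x = ℓ' (r • x) - ℓ (r • x) := by
            simp only [map_smul, smul_eq_mul, _root_.sub_apply]; ring
        _ ≤ C * (2 * ρ * a ^ 4) + C * (2 * ρ * a ^ 4) := by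
            linarith [herr δ hδ, herr δ' hδ']
        _ = _ := by rw [hr]; ring
    exact le_of_mul_le_mul_left h4 hr0
  rw [dist_comm, dist_eq_norm]
  refine ContinuousLinearMap.opNorm_le_of_unit_norm (by positivity) fun x hx => ?_
  rw [Real.norm_eq_abs, abs_le]
  have := key (-x) (by rwa [norm_neg])
  rw [map_neg] at this
  exact ⟨by linarith, key x hx⟩

/-- A function with first-order upper estimates at every scale that lies above a function with
first-order lower estimates, with equality at `x₀`: both are differentiable at `x₀`, with the same
derivative, which is a limit of the approximate upper derivatives. -/
lemma exists_hasFDerivAt_of_squeeze (hρ : 0 < ρ) (hρ1 : ρ ≤ 1) (hC : 0 ≤ C) (heq : f x₀ = g x₀)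
    (hle : ∀ z, ‖z‖ ≤ ρ → g (x₀ + z) ≤ f (x₀ + z)) {S : Set (X →L[ℝ] ℝ)} (hS : IsClosed S)
    (hf : ∀ δ, 0 < δ → δ ≤ ρ → ∃ ℓ ∈ S, ∀ z, ‖z‖ ≤ δ / 2 →
      f (x₀ + z) ≤ f x₀ + ℓ z + C * (‖z‖ ^ 2 / δ + δ ^ 2))
    (hg : ∀ δ, 0 < δ → δ ≤ ρ → ∃ ℓ : X →L[ℝ] ℝ, ∀ z, ‖z‖ ≤ δ / 2 →
      g x₀ + ℓ z - C * (‖z‖ ^ 2 / δ + δ ^ 2) ≤ g (x₀ + z)) :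
    ∃ ℓ ∈ S, HasFDerivAt f ℓ x₀ ∧ HasFDerivAt g ℓ x₀ := by
  have ha0 : ∀ k : ℕ, (0 : ℝ) < (1 / 2) ^ k := fun k => by positivity
  have ha1 : ∀ k : ℕ, (1 / 2 : ℝ) ^ k ≤ 1 := fun k => pow_le_one₀ (by norm_num) (by norm_num)
  have hd0 : ∀ k : ℕ, 0 < ρ * ((1 / 2) ^ k) ^ 2 := fun k => by positivity
  have hd1 : ∀ k : ℕ, ρ * ((1 / 2) ^ k) ^ 2 ≤ ρ := fun k =>
    mul_le_of_le_one_right hρ.le (pow_le_one₀ (ha0 k).le (ha1 k))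
  choose ℓ hℓS hℓ using fun k => hf _ (hd0 k) (hd1 k)
  choose ℓ' hℓ' using fun k => hg _ (hd0 k) (hd1 k)
  have hself : ∀ k, dist (ℓ k) (ℓ' k) ≤ 32 * C * (1 / 2) ^ k := fun k =>
    dist_le_of_squeeze hρ hρ1 hC heq hle (ha0 k) (ha1 k)
      ⟨by linarith [hd0 k], le_rfl⟩ ⟨by linarith [hd0 k], le_rfl⟩ (hℓ k) (hℓ' k)
  -- Two upper slopes cannot be compared directly; the lower slope `ℓ' k` is the intermediary.
  have hsucc : ∀ k, dist (ℓ (k + 1)) (ℓ' k) ≤ 32 * C * (1 / 2) ^ k := fun k => by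
    have e : ρ * ((1 / 2) ^ (k + 1)) ^ 2 = ρ * ((1 / 2) ^ k) ^ 2 / 4 := by ring
    exact dist_le_of_squeeze hρ hρ1 hC heq hle (ha0 k) (ha1 k)
      ⟨e.ge, by rw [e]; linarith [hd0 k]⟩ ⟨by linarith [hd0 k], le_rfl⟩ (hℓ (k + 1)) (hℓ' k)
  have hgeo : ∀ k, dist (ℓ k) (ℓ (k + 1)) ≤ 64 * C * (1 / 2) ^ k := fun k => by
    have := dist_triangle_right (ℓ k) (ℓ (k + 1)) (ℓ' k)
    linarith [hself k, hsucc k]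
  obtain ⟨m, hm⟩ := cauchySeq_tendsto_of_complete
    (cauchySeq_of_le_geometric (1 / 2) (64 * C) (by norm_num) hgeo)
  have hmS : m ∈ S := hS.mem_of_tendsto hm (Filter.Eventually.of_forall hℓS)
  have hdist : ∀ k, dist (ℓ k) m ≤ 160 * C * (1 / 2) ^ k := fun k => by
    have := dist_le_of_le_geometric_of_tendsto (1 / 2) (64 * C) (by norm_num) hgeo hm k
    rw [sub_half, div_div_eq_mul_div, div_one] at this
    have h2 := mul_nonneg hC (ha0 k).le
    linarith
  have hdist' : ∀ k, dist (ℓ' k) m ≤ 160 * C * (1 / 2) ^ k := fun k => by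
    have := dist_le_of_le_geometric_of_tendsto (1 / 2) (64 * C) (by norm_num) hgeo hm k
    rw [sub_half, div_div_eq_mul_div, div_one] at this
    have h2 := dist_triangle_left (ℓ' k) m (ℓ k)
    linarith [hself k]
  have happ : ∀ (k : ℕ) (q : X →L[ℝ] ℝ) (z : X), dist q m ≤ 160 * C * (1 / 2) ^ k →
      |q z - m z| ≤ 160 * C * (1 / 2) ^ k * ‖z‖ := fun k q z h => by
    rw [dist_eq_norm] at h
    exact ((q - m).le_opNorm z).trans (mul_le_mul_of_nonneg_right h (norm_nonneg _))
  have key : ∀ η > 0, ∀ z, ‖z‖ ≤ ρ / 8 → ‖z‖ < ρ * η ^ 3 / 64 →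
      f (x₀ + z) - f x₀ - m z ≤ 225 * C * η * ‖z‖ ∧
      -(225 * C * η * ‖z‖) ≤ g (x₀ + z) - g x₀ - m z := by
    intro η hη z hz1 hz2
    rcases eq_or_ne z 0 with rfl | hz0
    · simp
    have hzpos : 0 < ‖z‖ := norm_pos_iff.2 hz0
    -- The scale is matched to `z`: `ρa³/64 < ‖z‖ ≤ ρa³/8`, so both error terms are `O(a‖z‖)`, with
    -- `a ≤ η`. The final 225 is 160 from the slope plus 65 from these errors.
    obtain ⟨k, hk1, hk2⟩ := exists_nat_pow_near_of_lt_one (x := 8 * ‖z‖ / ρ) (y := (1 / 8 : ℝ))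
      (by positivity) ((div_le_one hρ).2 (by linarith)) (by norm_num) (by norm_num)
    set a : ℝ := (1 / 2) ^ k with ha
    have hap : 0 < a := ha0 k
    have e8 : (1 / 8 : ℝ) ^ k = a ^ 3 := by rw [ha, ← pow_mul, mul_comm, pow_mul]; norm_num
    rw [pow_succ, e8, lt_div_iff₀ hρ] at hk1
    rw [e8, div_le_iff₀ hρ] at hk2
    have haη : a ≤ η := by
      have : a ^ 3 < η ^ 3 := by
        have : ρ * a ^ 3 < ρ * η ^ 3 := by linarith
        exact lt_of_mul_lt_mul_left this hρ.le
      exact (lt_of_pow_lt_pow_left₀ 3 hη.le this).le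
    have ha32 : ρ * a ^ 3 ≤ ρ * a ^ 2 :=
      mul_le_mul_of_nonneg_left (pow_le_pow_of_le_one hap.le (ha1 k) (by norm_num)) hρ.le
    have hzr : ‖z‖ ≤ ρ * a ^ 2 / 2 := by linarith
    have herr : C * (‖z‖ ^ 2 / (ρ * a ^ 2) + (ρ * a ^ 2) ^ 2) ≤ 65 * C * a * ‖z‖ := by
      have h1 : ‖z‖ ^ 2 / (ρ * a ^ 2) ≤ a * ‖z‖ := by
        rw [div_le_iff₀ (hd0 k)]
        calc ‖z‖ ^ 2 = ‖z‖ * ‖z‖ := by ring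
          _ ≤ ‖z‖ * (ρ * a ^ 3) := by gcongr; linarith
          _ = _ := by ring
      have h2 : (ρ * a ^ 2) ^ 2 ≤ 64 * a * ‖z‖ := by
        calc (ρ * a ^ 2) ^ 2 = ρ * (a * (ρ * a ^ 3)) := by ring
          _ ≤ 1 * (a * (64 * ‖z‖)) := by
            have : ρ * a ^ 3 ≤ 64 * ‖z‖ := by linarith
            gcongr ?_ * (a * ?_)
          _ = _ := by ring
      calc _ ≤ C * (a * ‖z‖ + 64 * a * ‖z‖) := by gcongr
        _ = _ := by ring
    have hη' : 225 * C * a * ‖z‖ ≤ 225 * C * η * ‖z‖ := by gcongr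
    have h1 := hℓ k z hzr
    have h2 := hℓ' k z hzr
    have h3 := abs_le.1 (happ k _ z (hdist k))
    have h4 := abs_le.1 (happ k _ z (hdist' k))
    constructor <;> linarith [h3.2, h4.1]
  have hev : ∀ ε > 0, ∀ᶠ z in nhds (0 : X), f (x₀ + z) - f x₀ - m z ≤ ε * ‖z‖ ∧
      -(ε * ‖z‖) ≤ g (x₀ + z) - g x₀ - m z ∧ g (x₀ + z) ≤ f (x₀ + z) := by
    intro ε hε
    set η := ε / (225 * C + 1) with hη
    have hη0 : 0 < η := by positivity
    have hηε : 225 * C * η ≤ ε := by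
      rw [hη, mul_div_assoc', div_le_iff₀ (by positivity)]; linarith
    have hball : Metric.ball (0 : X) (min (ρ / 8) (ρ * η ^ 3 / 64)) ∈ nhds (0 : X) :=
      Metric.ball_mem_nhds _ (by positivity)
    filter_upwards [hball] with z hz
    rw [mem_ball_zero_iff, lt_min_iff] at hz
    have h := key η hη0 z hz.1.le hz.2
    have h' : 225 * C * η * ‖z‖ ≤ ε * ‖z‖ := by gcongr
    exact ⟨by linarith [h.1], by linarith [h.2], hle z (by linarith [hz.1])⟩
  refine ⟨m, hmS, ?_, ?_⟩
  · rw [hasFDerivAt_iff_isLittleO_nhds_zero, Asymptotics.isLittleO_iff]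
    intro ε hε
    filter_upwards [hev ε hε] with z hz
    rw [Real.norm_eq_abs, abs_le]
    exact ⟨by linarith [hz.2.1, hz.2.2], hz.1⟩
  · rw [hasFDerivAt_iff_isLittleO_nhds_zero, Asymptotics.isLittleO_iff]
    intro ε hε
    filter_upwards [hev ε hε] with z hz
    rw [Real.norm_eq_abs, abs_le]
    exact ⟨hz.2.1, by linarith [hz.1, hz.2.2]⟩

end Squeeze

/-! ### Time reversal and differentiability on the reversibility set -/

variable {n : ℕ} {T B L : ℝ} {P φ φf φb : Space n × ℝ → ℝ}

lemma orbitAction_reverse (P : Space n × ℝ → ℝ) (s t : ℝ) (γ : ℝ → Space n) :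
    orbitAction (reverse T P) s t (fun τ => γ (T - τ)) = orbitAction P (T - t) (T - s) γ := by
  unfold orbitAction reverse
  rw [← intervalIntegral.integral_comp_sub_left (fun τ => ‖deriv γ τ‖ ^ 2 / 2 + P (γ τ, τ)) T]
  simp only [deriv_comp_const_sub, norm_neg]

lemma minimalAction_reverse (P : Space n × ℝ → ℝ) (x y : Space n) (s t : ℝ) :
    minimalAction (reverse T P) y x s t = minimalAction P x y (T - t) (T - s) := by
  unfold minimalAction
  congr 1
  ext A
  constructor
  · rintro ⟨γ, hγ, hs, ht, rfl⟩
    refine ⟨fun τ => γ (T - τ), by fun_prop, by simpa using ht, by simpa using hs, ?_⟩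
    have := orbitAction_reverse (T := T) P s t (fun τ => γ (T - τ))
    simpa using this
  · rintro ⟨γ, hγ, hs, ht, rfl⟩
    exact ⟨fun τ => γ (T - τ), by fun_prop, ht, hs, (orbitAction_reverse P s t γ).symm⟩

/-- Time reversal turns backward solutions into forward solutions. -/
lemma IsBackwardSolution.isForwardSolution_reverse (hφ : IsBackwardSolution T P φ) :
    IsForwardSolution T (reverse T P) (-reverse T φ) := by
  refine ⟨fun z x t ht => ?_, fun x t₀ ht₀ t₁ ht₁ h => ?_⟩
  · simp only [Pi.neg_apply, reverse, hφ.periodic z x _ (sub_mem_Icc_zero ht)]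
  · have h1 := hφ.isLUB x _ (sub_mem_Icc_zero ht₁) _ (sub_mem_Icc_zero ht₀) (by linarith)
    constructor
    · rintro _ ⟨y, rfl⟩
      have h2 := h1.1 ⟨y, rfl⟩
      have := minimalAction_reverse (T := T) P x y t₀ t₁
      dsimp [reverse] at h2 ⊢
      linarith
    · intro b hb
      have h2 : φ (x, T - t₁) ≤ -b := by
        apply h1.2
        rintro _ ⟨y, rfl⟩
        have h3 := hb ⟨y, rfl⟩
        have := minimalAction_reverse (T := T) P x y t₀ t₁
        dsimp [reverse] at h3 ⊢
        linarith
      dsimp [reverse]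
      linarith

/-- Each competitor in the supremum defining `φb` from time `T` is at most `φf (x, t)`, by the
forward inequality and the common final value. -/
lemma IsReversiblePair.le (hφ : IsReversiblePair T P φf φb) (hT : 0 < T)
    (x : Space n) {t : ℝ} (ht : t ∈ Icc 0 T) : φb (x, t) ≤ φf (x, t) := by
  rcases ht.2.eq_or_lt with rfl | h
  · exact (hφ.final x).ge
  refine (hφ.backward.isLUB x t ht T ⟨hT.le, le_rfl⟩ h).2 ?_
  rintro _ ⟨y, rfl⟩
  have := (hφ.forward.isGLB y t ht T ⟨hT.le, le_rfl⟩ h).1 ⟨x, rfl⟩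
  dsimp at this ⊢
  rw [← hφ.final]
  linarith

/-- The linear functional with gradient `(v, c)`. -/
def gradientFunctional (v : Space n) (c : ℝ) : Space n × ℝ →L[ℝ] ℝ :=
  (innerSL ℝ v).comp (ContinuousLinearMap.fst ℝ _ _) + c • ContinuousLinearMap.snd ℝ _ _

@[simp] lemma gradientFunctional_apply (v : Space n) (c : ℝ) (z : Space n × ℝ) :
    gradientFunctional v c z = inner ℝ v z.1 + c * z.2 := by
  simp [gradientFunctional]

/-- The equation is a closed condition on the derivative, so it survives the limit of the
approximate slopes. -/
lemma isClosed_range_gradientFunctional (c : ℝ) :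
    IsClosed (range fun v : Space n => gradientFunctional v (c - ‖v‖ ^ 2 / 2)) := by
  have e : (range fun v : Space n => gradientFunctional v (c - ‖v‖ ^ 2 / 2)) =
      {ℓ | ℓ (0, 1) = c - ‖ℓ.comp (ContinuousLinearMap.inl ℝ (Space n) ℝ)‖ ^ 2 / 2} := by
    ext ℓ
    constructor
    · rintro ⟨v, rfl⟩
      have : (gradientFunctional v (c - ‖v‖ ^ 2 / 2)).comp
          (ContinuousLinearMap.inl ℝ (Space n) ℝ) = innerSL ℝ v := by
        ext ξ; simp
      simp [this]
    · intro hℓ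
      set v := (InnerProductSpace.toDual ℝ (Space n)).symm
        (ℓ.comp (ContinuousLinearMap.inl ℝ (Space n) ℝ)) with hv
      have hnorm : ‖v‖ = ‖ℓ.comp (ContinuousLinearMap.inl ℝ (Space n) ℝ)‖ :=
        LinearIsometryEquiv.norm_map _ _
      refine ⟨v, ContinuousLinearMap.ext fun z => ?_⟩
      have h1 : inner ℝ v z.1 = ℓ (z.1, 0) := by
        rw [hv, InnerProductSpace.toDual_symm_apply]; rfl
      have h2 : z = (z.1, 0) + z.2 • ((0, 1) : Space n × ℝ) := by simp
      rw [gradientFunctional_apply, h1, hnorm, ← hℓ.out]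
      conv_rhs => rw [h2, map_add, map_smul, smul_eq_mul]
      ring
  rw [e]
  have hc : Continuous fun ℓ : Space n × ℝ →L[ℝ] ℝ =>
      ℓ.comp (ContinuousLinearMap.inl ℝ (Space n) ℝ) :=
    (ContinuousLinearMap.compL ℝ (Space n) (Space n × ℝ) ℝ).flip
      (ContinuousLinearMap.inl ℝ (Space n) ℝ) |>.continuous
  exact isClosed_eq ((ContinuousLinearMap.apply ℝ ℝ ((0, 1) : Space n × ℝ)).continuous)
    (continuous_const.sub ((hc.norm.pow 2).div_const 2))

/-- At a point of the reversibility set both solutions are differentiable with the same gradient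
`(v, c)`, and `c + |v|²/2 = P`. -/
lemma IsReversiblePair.exists_hasFDerivAt (hφ : IsReversiblePair T P φf φb)
    (hP : LipschitzPressure T B L P) (hT : 0 < T) {p : Space n × ℝ}
    (hp : p ∈ reversibilitySet T φf φb) :
    ∃ v : Space n, HasFDerivAt φf (gradientFunctional v (P p - ‖v‖ ^ 2 / 2)) p ∧
      HasFDerivAt φb (gradientFunctional v (P p - ‖v‖ ^ 2 / 2)) p := by
  obtain ⟨x₀, t₀⟩ := p
  obtain ⟨ht₀, heq⟩ := hp
  dsimp at ht₀
  have ht₀' : T - t₀ ∈ Ioo 0 T := ⟨by linarith [ht₀.2], by linarith [ht₀.1]⟩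
  obtain ⟨C, ρ, hC, hρ, hf⟩ := hφ.forward.exists_upper_estimate hP hT ht₀ x₀
  obtain ⟨C', ρ', hC', hρ', hg⟩ := hφ.backward.isForwardSolution_reverse.exists_upper_estimate
    hP.comp_reverse hT ht₀' x₀
  set r := min (min ρ ρ') (min 1 (min t₀ (T - t₀))) with hr
  have hr0 : 0 < r := lt_min (lt_min hρ hρ') (lt_min one_pos (lt_min ht₀.1 ht₀'.1))
  have h1 : r ≤ ρ := (min_le_left _ _).trans (min_le_left _ _)
  have h2 : r ≤ ρ' := (min_le_left _ _).trans (min_le_right _ _)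
  have h3 : r ≤ 1 := (min_le_right _ _).trans (min_le_left _ _)
  have h4 : r ≤ t₀ := (min_le_right _ _).trans ((min_le_right _ _).trans (min_le_left _ _))
  have h5 : r ≤ T - t₀ := (min_le_right _ _).trans ((min_le_right _ _).trans (min_le_right _ _))
  have hfst : ∀ z : Space n × ℝ, ‖z.1‖ ≤ ‖z‖ := fun z => norm_fst_le z
  have hsnd : ∀ z : Space n × ℝ, |z.2| ≤ ‖z‖ := fun z => norm_snd_le z
  have hmax : ∀ z : Space n × ℝ, max ‖z.1‖ |z.2| = ‖z‖ := fun z => rfl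
  have := exists_hasFDerivAt_of_squeeze (f := φf) (g := φb) (x₀ := (x₀, t₀)) (C := max C C')
    hr0 h3 (hC.trans (le_max_left _ _)) heq (fun z hz => ?_)
    (isClosed_range_gradientFunctional (P (x₀, t₀))) (fun δ hδ hδr => ?_) (fun δ hδ hδr => ?_)
  · obtain ⟨_, ⟨v, rfl⟩, hv⟩ := this
    exact ⟨v, hv⟩
  · have hz2 := abs_le.1 ((hsnd z).trans hz)
    exact hφ.le hT (x₀ + z.1) (t := t₀ + z.2) ⟨by linarith, by linarith⟩
  · obtain ⟨u, hu⟩ := hf δ hδ (hδr.trans h1)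
    refine ⟨_, ⟨u, rfl⟩, fun z hz => ?_⟩
    have h := hu z.1 z.2 ((hfst z).trans hz) ((hsnd z).trans hz)
    rw [hmax] at h
    have hCC : C * (‖z‖ ^ 2 / δ + δ ^ 2) ≤ max C C' * (‖z‖ ^ 2 / δ + δ ^ 2) := by
      gcongr; exact le_max_left _ _
    rw [gradientFunctional_apply]
    change φf (x₀ + z.1, t₀ + z.2) ≤ _
    linarith
  · obtain ⟨u, hu⟩ := hg δ hδ (hδr.trans h2)
    -- The sign change reverses the spatial slope; in the time slope it cancels against the time
    -- reversal.
    refine ⟨gradientFunctional (-u) (P (x₀, t₀) - ‖u‖ ^ 2 / 2), fun z hz => ?_⟩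
    have h := hu z.1 (-z.2) ((hfst z).trans hz) (by rw [abs_neg]; exact (hsnd z).trans hz)
    rw [abs_neg, hmax] at h
    have hCC : C' * (‖z‖ ^ 2 / δ + δ ^ 2) ≤ max C C' * (‖z‖ ^ 2 / δ + δ ^ 2) := by
      gcongr; exact le_max_right _ _
    simp only [Pi.neg_apply, reverse, sub_sub_cancel] at h
    rw [show T - (T - t₀ + -z.2) = t₀ + z.2 by ring] at h
    rw [gradientFunctional_apply, inner_neg_left]
    change _ ≤ φb (x₀ + z.1, t₀ + z.2)
    linarith

lemma hasFDerivAt_slice {x : Space n} {t : ℝ} {v : Space n} {c : ℝ}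
    (h : HasFDerivAt φ (gradientFunctional v c) (x, t)) :
    HasFDerivAt (fun y => φ (y, t)) (innerSL ℝ v) x := by
  have h1 : HasFDerivAt (fun y : Space n => (y, t)) (ContinuousLinearMap.inl ℝ (Space n) ℝ) x :=
    hasFDerivAt_prodMk_left x t
  have h2 := HasFDerivAt.comp (g := φ) x h h1
  have e : (gradientFunctional v c).comp (ContinuousLinearMap.inl ℝ (Space n) ℝ) = innerSL ℝ v := by
    ext ξ; simp
  rw [e] at h2
  exact h2

lemma fullGradient_of_hasFDerivAt {p : Space n × ℝ} {v : Space n} {c : ℝ}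
    (h : HasFDerivAt φ (gradientFunctional v c) p) : fullGradient φ p = (v, c) := by
  have hx : HasGradientAt (fun x => φ (x, p.2)) v p.1 :=
    hasGradientAt_iff_hasFDerivAt.2 (hasFDerivAt_slice h)
  have ht : HasDerivAt (fun t => φ (p.1, t)) c p.2 := by
    have h1 : HasFDerivAt (fun t : ℝ => (p.1, t))
      (ContinuousLinearMap.inr ℝ (Space n) ℝ) p.2 := hasFDerivAt_prodMk_right p.1 p.2
    have h2 := (HasFDerivAt.comp (g := φ) p.2 h h1).hasDerivAt
    have e : (gradientFunctional v c).comp (ContinuousLinearMap.inr ℝ (Space n) ℝ) 1 = c := by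
      simp
    rw [e] at h2
    exact h2
  rw [fullGradient, spaceGradient, timeDerivative, hx.gradient, ht.deriv]

end

/-! ### Semiconcavity and quadratic estimates at fixed time -/

section

variable {n : ℕ} {T B L : ℝ} {P φ φf φb : Space n × ℝ → ℝ}

/-- The weights `a`, `b` average the two points to `x`, and the corresponding average of `‖·‖²`
exceeds `‖x‖²` by exactly `a * b * ‖η‖²`. -/
lemma semiconcave_of_concaveOn {f : Space n → ℝ} {c : ℝ}
    (hf : ConcaveOn ℝ univ fun x => f x - c * ‖x‖ ^ 2) {a b : ℝ} (ha : 0 ≤ a) (hb : 0 ≤ b)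
    (hab : a + b = 1) (x η : Space n) :
    a * f (x + b • η) + b * f (x + (-a) • η) ≤ f x + c * (a * b * ‖η‖ ^ 2) := by
  have h := hf.2 (mem_univ (x + b • η)) (mem_univ (x + (-a) • η)) ha hb hab
  have e : a • (x + b • η) + b • (x + (-a) • η) = x := by
    calc a • (x + b • η) + b • (x + (-a) • η) = (a + b) • x := by module
      _ = x := by rw [hab, one_smul]
  rw [e] at h
  simp only [smul_eq_mul] at h
  rw [norm_add_sq_real, norm_add_sq_real, real_inner_smul_right, real_inner_smul_right,
    norm_smul, norm_smul, mul_pow, mul_pow, Real.norm_eq_abs, Real.norm_eq_abs, sq_abs,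
    sq_abs] at h
  obtain rfl : b = 1 - a := by linarith
  nlinarith

/-- Forward solutions inherit semiconcavity in space from the pressure. -/
lemma IsForwardSolution.semiconcave (hφ : IsForwardSolution T P φ)
    (hP : LipschitzPressure T B L P) {s t : ℝ} (hs : 0 ≤ s) (hst : s < t) (ht : t ≤ T)
    {C : ℝ → ℝ} (hCi : IntervalIntegrable C volume s t)
    (hC : ∀ τ ∈ Icc s t, 0 ≤ C τ ∧ ConcaveOn ℝ univ fun x : Space n => P (x, τ) - C τ * ‖x‖ ^ 2)
    {a b : ℝ} (ha : 0 ≤ a) (hb : 0 ≤ b) (hab : a + b = 1) (x η : Space n) :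
    a * φ (x + b • η, t) + b * φ (x + (-a) • η, t) ≤
      φ (x, t) + (1 / (2 * (t - s)) + ∫ τ in s..t, C τ) * (a * b * ‖η‖ ^ 2) := by
  have h0 : 0 < t - s := by linarith
  refine le_of_forall_pos_le_add fun ε hε => ?_
  obtain ⟨γ, hγ, hγt, hlt⟩ := hφ.exists_orbit hs hst ht x hε
  -- One orbit serves both endpoints; in the average with weights `a`, `b` the terms linear in `ξ`
  -- cancel.
  have hup : ∀ ξ : Space n, φ (x + ξ, t) ≤ φ (γ s, s) + (orbitAction P s t γ +
      inner ℝ ((t - s)⁻¹ • (x - γ s)) ξ + ‖ξ‖ ^ 2 / (2 * (t - s)) +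
      ∫ τ in s..t, (P (displace γ s t ξ τ, τ) - P (γ τ, τ))) := by
    intro ξ
    have h := hφ.le_add_orbitAction hP hs hst ht (contDiff_displace (s := s) (t := t) hγ ξ)
    rwa [displace_left, displace_right hst, hγt, hP.orbitAction_displace hs hst ht hγ, hγt] at h
  have h1 := mul_le_mul_of_nonneg_left (hup (b • η)) ha
  have h2 := mul_le_mul_of_nonneg_left (hup ((-a) • η)) hb
  rw [real_inner_smul_right, norm_smul, mul_pow, Real.norm_eq_abs, sq_abs] at h1 h2
  have hint : ∀ ξ : Space n, IntervalIntegrable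
      (fun τ => P (displace γ s t ξ τ, τ) - P (γ τ, τ)) volume s t := fun ξ =>
    (hP.intervalIntegrable_comp hs hst.le ht (contDiff_displace hγ ξ).continuous).sub
        (hP.intervalIntegrable_comp hs hst.le ht hγ.continuous)
  have h3 : a * (∫ τ in s..t, (P (displace γ s t (b • η) τ, τ) - P (γ τ, τ))) +
      b * (∫ τ in s..t, (P (displace γ s t ((-a) • η) τ, τ) - P (γ τ, τ))) ≤
      (∫ τ in s..t, C τ) * (a * b * ‖η‖ ^ 2) := by
    rw [← intervalIntegral.integral_const_mul, ← intervalIntegral.integral_const_mul,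
      ← intervalIntegral.integral_mul_const, ← intervalIntegral.integral_add
      ((hint _).const_mul _) ((hint _).const_mul _)]
    refine intervalIntegral.integral_mono_on hst.le (((hint _).const_mul _).add
      ((hint _).const_mul _)) (hCi.mul_const _) fun τ hτ => ?_
    obtain ⟨hC0, hCc⟩ := hC τ hτ
    set θ := (τ - s) / (t - s) with hθ
    have hθ0 : 0 ≤ θ := div_nonneg (by linarith [hτ.1]) h0.le
    have hθ1 : θ ≤ 1 := (div_le_one h0).2 (by linarith [hτ.2])
    have h4 := semiconcave_of_concaveOn (f := fun x => P (x, τ)) hCc ha hb hab (γ τ) (θ • η)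
    have e : ∀ c : ℝ, displace γ s t (c • η) τ = γ τ + c • θ • η := fun c => by
      rw [displace, ← hθ, smul_comm]
    rw [e, e]
    have h5 : ‖θ • η‖ ^ 2 ≤ ‖η‖ ^ 2 := by
      rw [norm_smul, Real.norm_of_nonneg hθ0]
      gcongr
      exact mul_le_of_le_one_left (norm_nonneg _) hθ1
    have h6 : C τ * (a * b * ‖θ • η‖ ^ 2) ≤ C τ * (a * b * ‖η‖ ^ 2) := by gcongr
    have h7 : a * P (γ τ, τ) + b * P (γ τ, τ) = P (γ τ, τ) := by rw [← add_mul, hab, one_mul]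
    linarith
  have e1 : a * (b ^ 2 * ‖η‖ ^ 2 / (2 * (t - s))) + b * ((-a) ^ 2 * ‖η‖ ^ 2 / (2 * (t - s))) =
      (a + b) * (1 / (2 * (t - s)) * (a * b * ‖η‖ ^ 2)) := by ring
  rw [hab, one_mul] at e1
  have e2 : a * (φ (γ s, s) + orbitAction P s t γ) + b * (φ (γ s, s) + orbitAction P s t γ) =
      φ (γ s, s) + orbitAction P s t γ := by rw [← add_mul, hab, one_mul]
  linarith

/-- Semiconcavity between `x₀` and `x₀ + ξ`, read at `x₀ + a • ξ`, bounds the difference quotient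
below; then `a → 0`. -/
lemma le_of_semiconcave_of_hasFDerivAt {f : Space n → ℝ} {k : ℝ} {x₀ v : Space n}
    (hf : ∀ a b : ℝ, 0 ≤ a → 0 ≤ b → a + b = 1 → ∀ x η,
      a * f (x + b • η) + b * f (x + (-a) • η) ≤ f x + k * (a * b * ‖η‖ ^ 2))
    (hk : 0 ≤ k) (hd : HasFDerivAt f (innerSL ℝ v) x₀) (ξ : Space n) :
    f (x₀ + ξ) ≤ f x₀ + inner ℝ v ξ + k * ‖ξ‖ ^ 2 := by
  have hlim := (hd.hasLineDerivAt ξ).tendsto_slope_zero_right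
  have : f (x₀ + ξ) - f x₀ - k * ‖ξ‖ ^ 2 ≤ innerSL ℝ v ξ := by
    refine ge_of_tendsto hlim ?_
    filter_upwards [Ioo_mem_nhdsGT (zero_lt_one' ℝ)] with a ha
    have h := hf a (1 - a) ha.1.le (by linarith [ha.2]) (by ring) (x₀ + a • ξ) ξ
    have e1 : x₀ + a • ξ + (1 - a) • ξ = x₀ + ξ := by module
    have e2 : x₀ + a • ξ + (-a) • ξ = x₀ := by module
    rw [e1, e2] at h
    rw [smul_eq_mul, inv_mul_eq_div, le_div_iff₀ ha.1]
    have h2 : 0 ≤ k * (a * a * ‖ξ‖ ^ 2) :=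
      mul_nonneg hk (mul_nonneg (mul_self_nonneg a) (sq_nonneg _))
    linarith
  rw [innerSL_apply_apply] at this
  linarith

/-- Two-sided quadratic estimates at the points of the reversibility set, uniformly for times in a
compact subinterval of `(0,T)`. -/
lemma IsReversiblePair.exists_quadratic_estimate (hφ : IsReversiblePair T P φf φb)
    (hP : LipschitzPressure T B L P) (hsc : IsSemiconcavePressure T P) {a b : ℝ} (ha : 0 < a)
    (hab : a < b) (hb : b < T) :
    ∃ k, 0 ≤ k ∧ ∀ x, ∀ t ∈ Icc a b, ∀ v c,
      HasFDerivAt φf (gradientFunctional v c) (x, t) →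
      HasFDerivAt φb (gradientFunctional v c) (x, t) → ∀ ξ,
        φf (x + ξ, t) ≤ φf (x, t) + inner ℝ v ξ + k * ‖ξ‖ ^ 2 ∧
        φb (x, t) + inner ℝ v ξ - k * ‖ξ‖ ^ 2 ≤ φb (x + ξ, t) := by
  obtain ⟨C, hCi, hC⟩ := hsc
  -- A margin keeping the windows `[t-δ,t]` and `[t,t+δ]` in a compact subset of `(0,T)`, where `C`
  -- is integrable.
  set δ := min a (T - b) / 2 with hδ
  have hδ0 : 0 < δ := half_pos (lt_min ha (by linarith))
  have hδa : δ ≤ a / 2 := by rw [hδ]; linarith [min_le_left a (T - b)]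
  have hδb : δ ≤ (T - b) / 2 := by rw [hδ]; linarith [min_le_right a (T - b)]
  have hsub : Icc (a - δ) (b + δ) ⊆ Ioo 0 T := fun t ht =>
    ⟨by linarith [ht.1], by linarith [ht.2]⟩
  have hInt : ∀ s t, a - δ ≤ s → s ≤ t → t ≤ b + δ → IntervalIntegrable C volume s t := by
    intro s t hs hst ht
    rw [intervalIntegrable_iff_integrableOn_Icc_of_le hst]
    exact hCi.integrableOn_compact_subset ((Icc_subset_Icc hs ht).trans hsub) isCompact_Icc
  set I := ∫ τ in (a - δ)..(b + δ), C τ with hI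
  have hle : ∀ s t, a - δ ≤ s → s ≤ t → t ≤ b + δ →
      0 ≤ ∫ τ in s..t, C τ ∧ ∫ τ in s..t, C τ ≤ I := by
    intro s t hs hst ht
    constructor
    · exact intervalIntegral.integral_nonneg hst fun τ hτ =>
        (hC τ (hsub ⟨by linarith [hτ.1], by linarith [hτ.2]⟩)).1.le
    · refine intervalIntegral.integral_mono_interval hs hst ht ?_
        (hInt _ _ le_rfl (by linarith) le_rfl)
      filter_upwards [self_mem_ae_restrict measurableSet_Ioc] with τ hτ
      exact (hC τ (hsub (Ioc_subset_Icc_self hτ))).1.le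
  have hI0 : 0 ≤ I := (hle _ _ le_rfl (by linarith) le_rfl).1
  refine ⟨1 / (2 * δ) + I, by positivity, fun x t ht v c hf hb' ξ => ⟨?_, ?_⟩⟩
  · have hs : a - δ ≤ t - δ := by linarith [ht.1]
    have ht' : t ≤ b + δ := by linarith [ht.2]
    have h := le_of_semiconcave_of_hasFDerivAt (f := fun y => φf (y, t))
      (fun a' b' ha' hb' hab' y η => hφ.forward.semiconcave hP (s := t - δ) (t := t)
        (by linarith [ht.1]) (by linarith) (by linarith) (hInt _ _ hs (by linarith) ht')
        (fun τ hτ => ?_) ha' hb' hab' y η) ?_ (hasFDerivAt_slice hf) ξ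
    · refine h.trans ?_
      rw [sub_sub_cancel]
      gcongr
      exact (hle _ _ hs (by linarith) ht').2
    · have := hC τ (hsub ⟨by linarith [hτ.1], by linarith [hτ.2]⟩)
      exact ⟨this.1.le, this.2⟩
    · rw [sub_sub_cancel]
      exact add_nonneg (by positivity) (hle _ _ hs (by linarith) ht').1
  · have hs : a - δ ≤ t := by linarith [ht.1]
    have ht' : t + δ ≤ b + δ := by linarith [ht.2]
    have hCi' : IntervalIntegrable (fun τ => C (T - τ)) volume (T - t - δ) (T - t) := by
      have := (hInt _ _ hs (by linarith) ht').comp_sub_left T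
      rw [← sub_sub] at this
      exact this.symm
    have hCI : ∫ τ in (T - t - δ)..(T - t), C (T - τ) = ∫ τ in t..(t + δ), C τ := by
      rw [intervalIntegral.integral_comp_sub_left]
      congr 1 <;> ring
    have hd : HasFDerivAt (fun y => (-reverse T φb) (y, T - t)) (innerSL ℝ (-v)) x := by
      simp only [Pi.neg_apply, reverse, sub_sub_cancel]
      rw [map_neg]
      exact (hasFDerivAt_slice hb').neg
    have h := le_of_semiconcave_of_hasFDerivAt (f := fun y => (-reverse T φb) (y, T - t))
      (fun a' b' ha' hb' hab' y η => hφ.backward.isForwardSolution_reverse.semiconcave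
        hP.comp_reverse (s := T - t - δ) (t := T - t)
        (by linarith [ht.2]) (by linarith) (by linarith [ht.1]) hCi'
        (fun τ hτ => ?_) ha' hb' hab' y η) ?_ hd ξ
    · rw [hCI, sub_sub_cancel] at h
      simp only [Pi.neg_apply, reverse, sub_sub_cancel, inner_neg_left] at h
      have h2 : (1 / (2 * δ) + ∫ τ in t..(t + δ), C τ) * ‖ξ‖ ^ 2 ≤
          (1 / (2 * δ) + I) * ‖ξ‖ ^ 2 := by
        gcongr
        exact (hle _ _ hs (by linarith) ht').2
      linarith
    · have := hC (T - τ) (hsub ⟨by linarith [hτ.2, ht.1], by linarith [hτ.1, ht.2]⟩)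
      exact ⟨this.1.le, this.2⟩
    · rw [hCI, sub_sub_cancel]
      exact add_nonneg (by positivity) (hle _ _ hs (by linarith) ht').1

end

/-! ### Propagation in time and Lipschitz continuity of the gradient -/

section

variable {n : ℕ} {T B L : ℝ} {P φ φf φb : Space n × ℝ → ℝ}

/-- A quadratic upper estimate at time `t₀` propagates to later times. -/
lemma IsForwardSolution.upper_of_later (hφ : IsForwardSolution T P φ)
    (hP : LipschitzPressure T B L P) {t₀ t₁ k R : ℝ} (ht₀ : 0 ≤ t₀) (h01 : t₀ ≤ t₁) (ht₁ : t₁ ≤ T)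
    (hk : 0 ≤ k) {x₀ v : Space n} (hv : ‖v‖ ≤ R)
    (hq : ∀ ξ, φ (x₀ + ξ, t₀) ≤ φ (x₀, t₀) + inner ℝ v ξ + k * ‖ξ‖ ^ 2) (ξ : Space n) :
    φ (x₀ + ξ, t₁) ≤ φ (x₀, t₀) + inner ℝ v ξ + (P (x₀, t₀) - ‖v‖ ^ 2 / 2) * (t₁ - t₀) +
      (k * (1 + R) ^ 2 + L * (2 + R)) * (‖ξ‖ + (t₁ - t₀)) ^ 2 := by
  have hL := hP.nonneg_lip
  have hR : 0 ≤ R := (norm_nonneg _).trans hv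
  have hξ := norm_nonneg ξ
  rcases h01.eq_or_lt with rfl | hlt
  · refine (hq ξ).trans ?_
    have h1 : k * ‖ξ‖ ^ 2 ≤ (k * (1 + R) ^ 2 + L * (2 + R)) * ‖ξ‖ ^ 2 := by
      gcongr
      have : k * 1 ≤ k * (1 + R) ^ 2 := by
        gcongr; exact one_le_pow₀ (by linarith)
      have : 0 ≤ L * (2 + R) := by positivity
      linarith
    simpa using h1
  obtain ⟨h, hh⟩ : ∃ h, h = t₁ - t₀ := ⟨_, rfl⟩
  have hh0 : 0 < h := by linarith
  -- The competitor moves with velocity `v`, the gradient at the base point.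
  have h1 := hφ.le_add_orbitAction hP ht₀ hlt ht₁ (contDiff_line (x₀ + (ξ - h • v)) (x₀ + ξ) t₀ t₁)
  rw [line_left, line_right _ _ hlt] at h1
  have h2 := hP.orbitAction_line_le_frozen ht₀ hlt ht₁ (x₀ + (ξ - h • v)) (x₀ + ξ) x₀
    (t₀ := t₀) ⟨ht₀, by linarith⟩
  have e1 : x₀ + ξ - (x₀ + (ξ - h • v)) = h • v := by module
  rw [e1, add_sub_cancel_left, add_sub_cancel_left, sub_self, abs_zero, add_zero, ← hh,
    abs_of_pos hh0, norm_smul, Real.norm_of_nonneg hh0.le] at h2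
  have h3 := hq (ξ - h • v)
  rw [inner_sub_right, real_inner_smul_right, real_inner_self_eq_norm_sq] at h3
  have h4 : ‖ξ - h • v‖ ≤ ‖ξ‖ + h * R := by
    refine (norm_sub_le _ _).trans ?_
    rw [norm_smul, Real.norm_of_nonneg hh0.le]
    gcongr
  have h5 : ‖ξ - h • v‖ ≤ (1 + R) * (‖ξ‖ + h) := by
    have : 0 ≤ R * ‖ξ‖ := by positivity
    linarith
  have h6 : k * ‖ξ - h • v‖ ^ 2 ≤ k * (1 + R) ^ 2 * (‖ξ‖ + h) ^ 2 := by
    rw [mul_assoc, ← mul_pow]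
    gcongr
  have h7 : h * (L * (‖ξ‖ + ‖ξ - h • v‖ + h)) ≤ L * (2 + R) * (‖ξ‖ + h) ^ 2 := by
    calc h * (L * (‖ξ‖ + ‖ξ - h • v‖ + h)) ≤ (‖ξ‖ + h) * (L * ((2 + R) * (‖ξ‖ + h))) := by
          gcongr
          · linarith
          · linarith
      _ = _ := by ring
  have e2 : (h * ‖v‖) ^ 2 / (2 * h) = h * ‖v‖ ^ 2 / 2 := by field_simp
  rw [e2] at h2
  rw [← hh]
  linarith

/-- A quadratic lower estimate at time `t₀` propagates to slightly later times. -/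
lemma IsForwardSolution.lower_of_later (hφ : IsForwardSolution T P φ)
    (hP : LipschitzPressure T B L P) {t₀ t₁ k R : ℝ} (ht₀ : 0 ≤ t₀) (h01 : t₀ ≤ t₁) (ht₁ : t₁ ≤ T)
    (hk : 0 ≤ k) {x₀ v : Space n} (hv : ‖v‖ ≤ R) (hsmall : (t₁ - t₀) * (2 * L + 4 * k + 1) ≤ 1)
    (hq : ∀ ξ, φ (x₀, t₀) + inner ℝ v ξ - k * ‖ξ‖ ^ 2 ≤ φ (x₀ + ξ, t₀)) (ξ : Space n) :
    φ (x₀, t₀) + inner ℝ v ξ + (P (x₀, t₀) - ‖v‖ ^ 2 / 2) * (t₁ - t₀) -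
      (2 * k * (1 + R) ^ 2 + L * (3 + R) + L ^ 2) * (‖ξ‖ + (t₁ - t₀)) ^ 2 ≤ φ (x₀ + ξ, t₁) := by
  have hL := hP.nonneg_lip
  have hR : 0 ≤ R := (norm_nonneg _).trans hv
  have hξ := norm_nonneg ξ
  rcases h01.eq_or_lt with rfl | hlt
  · refine le_trans ?_ (hq ξ)
    have h1 : k * ‖ξ‖ ^ 2 ≤ (2 * k * (1 + R) ^ 2 + L * (3 + R) + L ^ 2) * ‖ξ‖ ^ 2 := by
      gcongr
      have : k * 1 ≤ k * (1 + R) ^ 2 := by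
        gcongr; exact one_le_pow₀ (by linarith)
      have : 0 ≤ L * (3 + R) + L ^ 2 := by positivity
      linarith
    rw [sub_self, mul_zero, add_zero, add_zero]
    linarith
  obtain ⟨h, hh⟩ : ∃ h, h = t₁ - t₀ := ⟨_, rfl⟩
  have hh0 : 0 < h := by linarith
  rw [← hh] at hsmall ⊢
  refine le_of_forall_pos_le_add fun ε hε => ?_
  obtain ⟨γ, hγ, hγt, hγlt⟩ := hφ.exists_orbit ht₀ hlt ht₁ (x₀ + ξ) hε
  have h1 := hP.le_orbitAction_of_frozen ht₀ hlt ht₁ hγ x₀ (t₀ := t₀) ⟨ht₀, by linarith⟩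
  -- The excess of the mean velocity over `v`. The term `h * inner ℝ v q` of the kinetic energy
  -- cancels the one from the initial estimate, leaving a gain `h * ‖q‖² / 2`.
  obtain ⟨q, hq'⟩ : ∃ q : Space n, q = h⁻¹ • (x₀ + ξ - γ t₀) - v := ⟨_, rfl⟩
  have hγ0 : γ t₀ = x₀ + (ξ - h • v - h • q) := by
    rw [hq', smul_sub, smul_smul, mul_inv_cancel₀ hh0.ne']; module
  have hγ1 : x₀ + ξ - γ t₀ = h • (v + q) := by rw [hγ0]; module
  rw [hγt, hγ1, hγ0, add_sub_cancel_left, add_sub_cancel_left, sub_self, abs_zero, add_zero, ← hh,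
    abs_of_pos hh0, norm_smul, Real.norm_of_nonneg hh0.le] at h1
  have h2 := hq (ξ - h • v - h • q)
  rw [← hγ0] at h2
  rw [inner_sub_right, inner_sub_right, real_inner_smul_right, real_inner_smul_right,
    real_inner_self_eq_norm_sq] at h2
  set Q := ‖q‖ with hQ
  have hQ0 : 0 ≤ Q := norm_nonneg _
  set r := ‖ξ‖ + h with hr
  have hr0 : 0 < r := by linarith
  have hhr : h ≤ r := by linarith
  have h3 : ‖ξ - h • v - h • q‖ ≤ (1 + R) * r + h * Q := by
    refine (norm_sub_le _ _).trans (add_le_add ((norm_sub_le _ _).trans ?_) ?_)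
    · rw [norm_smul, Real.norm_of_nonneg hh0.le]
      have h4 : h * ‖v‖ ≤ h * R := by gcongr
      have : 0 ≤ R * ‖ξ‖ := by positivity
      rw [hr]; linarith
    · rw [norm_smul, Real.norm_of_nonneg hh0.le]
  have h4 : k * ‖ξ - h • v - h • q‖ ^ 2 ≤ 2 * k * (1 + R) ^ 2 * r ^ 2 + 2 * k * h ^ 2 * Q ^ 2 := by
    have : ‖ξ - h • v - h • q‖ ^ 2 ≤ 2 * ((1 + R) * r) ^ 2 + 2 * (h * Q) ^ 2 := by
      calc _ ≤ ((1 + R) * r + h * Q) ^ 2 := by gcongr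
        _ ≤ _ := by linarith [sq_nonneg ((1 + R) * r - h * Q)]
    calc _ ≤ k * (2 * ((1 + R) * r) ^ 2 + 2 * (h * Q) ^ 2) := by gcongr
      _ = _ := by ring
  have h5 : h * (L * (‖ξ‖ + ‖ξ - h • v - h • q‖ + h)) ≤
      L * (3 + R) * r ^ 2 + L * h ^ 2 * Q ^ 2 := by
    have hQ1 : Q ≤ 1 + Q ^ 2 := by linarith [sq_nonneg (Q - 1 / 2)]
    have hh2 : h ^ 2 ≤ r ^ 2 := by gcongr
    calc h * (L * (‖ξ‖ + ‖ξ - h • v - h • q‖ + h)) ≤ h * (L * ((2 + R) * r + h * (1 + Q ^ 2))) := by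
          have : h * Q ≤ h * (1 + Q ^ 2) := by gcongr
          have : ‖ξ‖ + ‖ξ - h • v - h • q‖ + h ≤ (2 + R) * r + h * (1 + Q ^ 2) := by linarith
          gcongr
      _ = L * ((2 + R) * (h * r) + h ^ 2) + L * h ^ 2 * Q ^ 2 := by ring
      _ ≤ L * ((2 + R) * (r * r) + r ^ 2) + L * h ^ 2 * Q ^ 2 := by gcongr
      _ = _ := by ring
  have hh1 : h ≤ 1 := by
    have : 0 ≤ h * (2 * L + 4 * k) := by positivity
    linarith
  have h6 : L ^ 2 * h ^ 3 / 2 ≤ L ^ 2 * r ^ 2 := by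
    calc L ^ 2 * h ^ 3 / 2 ≤ L ^ 2 * h ^ 3 := half_le_self (by positivity)
      _ = L ^ 2 * (h ^ 2 * h) := by ring
      _ ≤ L ^ 2 * (r ^ 2 * 1) := by gcongr
      _ = _ := by ring
  -- For short times the kinetic gain absorbs every term in `Q`; this fixes the form of `hsmall`.
  have h7 : 2 * k * h ^ 2 * Q ^ 2 + L * h ^ 2 * Q ^ 2 ≤ h * Q ^ 2 / 2 := by
    have : h * Q ^ 2 * (h * (2 * L + 4 * k)) ≤ h * Q ^ 2 * 1 := by
      gcongr; linarith
    linarith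
  have e : (h * ‖v + q‖) ^ 2 / (2 * h) =
      h * ‖v‖ ^ 2 / 2 + h * inner ℝ v q + h * Q ^ 2 / 2 := by
    rw [mul_pow, norm_add_sq_real, ← hQ]; field_simp
  rw [e] at h1
  linarith

lemma norm_le_of_inner_le {v : Space n} {r K : ℝ} (hr : 0 < r)
    (h : ∀ w : Space n, ‖w‖ ≤ r → inner ℝ v w ≤ K * r) (hK : 0 ≤ K) : ‖v‖ ≤ K := by
  rcases eq_or_ne v 0 with rfl | hv
  · simpa using hK
  have hv0 : 0 < ‖v‖ := norm_pos_iff.2 hv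
  have h1 := h ((r / ‖v‖) • v) (by
    rw [norm_smul, Real.norm_of_nonneg (by positivity), div_mul_cancel₀ _ hv0.ne'])
  rw [real_inner_smul_right, real_inner_self_eq_norm_sq, div_mul_eq_mul_div, sq, ← mul_assoc,
    mul_div_cancel_right₀ _ hv0.ne', mul_comm] at h1
  exact le_of_mul_le_mul_right h1 hr

/-- For a semiconcave pressure the full gradient is locally Lipschitz on the reversibility set. -/
lemma IsReversiblePair.locallyLipschitzOn_fullGradient (hφ : IsReversiblePair T P φf φb)
    (hP : LipschitzPressure T B L P) (hT : 0 < T) (hsc : IsSemiconcavePressure T P) :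
    LocallyLipschitzOn (reversibilitySet T φf φb) (fullGradient φf) := by
  have hL := hP.nonneg_lip
  rintro ⟨xs, ts⟩ ⟨hts, -⟩
  dsimp at hts
  set a := ts / 2 with ha
  set b := (ts + T) / 2 with hb
  have ha0 : 0 < a := half_pos hts.1
  have hbT : b < T := by linarith [hts.2]
  have hab : a < b := by linarith [hts.1, hts.2]
  obtain ⟨k, hk, hquad⟩ := hφ.exists_quadratic_estimate hP hsc ha0 hab hbT
  obtain ⟨m, hm⟩ := hφ.forward.bddBelow hP hT
  obtain ⟨M, hM⟩ := hφ.forward.bddAbove hP ha0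
  obtain ⟨R, hR⟩ : ∃ R, R = k + |M - m| := ⟨_, rfl⟩
  have hR0 : 0 ≤ R := by rw [hR]; positivity
  choose! v hvf hvb using fun p hp => hφ.exists_hasFDerivAt hP hT (p := p) hp
  have hqf : ∀ p ∈ reversibilitySet T φf φb, p.2 ∈ Icc a b → ∀ ξ,
      φf (p.1 + ξ, p.2) ≤ φf p + inner ℝ (v p) ξ + k * ‖ξ‖ ^ 2 := fun p hp ht ξ =>
    (hquad p.1 p.2 ht _ _ (hvf p hp) (hvb p hp) ξ).1
  have hqb : ∀ p ∈ reversibilitySet T φf φb, p.2 ∈ Icc a b → ∀ ξ,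
      φf p + inner ℝ (v p) ξ - k * ‖ξ‖ ^ 2 ≤ φb (p.1 + ξ, p.2) := fun p hp ht ξ => by
    rw [hp.2]
    exact (hquad p.1 p.2 ht _ _ (hvf p hp) (hvb p hp) ξ).2
  have hIcc : ∀ t ∈ Icc a b, t ∈ Icc 0 T := fun t ht => ⟨by linarith [ht.1], by linarith [ht.2]⟩
  have hvR : ∀ p ∈ reversibilitySet T φf φb, p.2 ∈ Icc a b → ‖v p‖ ≤ R := fun p hp ht => by
    refine norm_le_of_inner_le one_pos (fun w hw => ?_) hR0
    have h1 := hqb p hp ht w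
    have h2 := hφ.le hT (p.1 + w) (hIcc _ ht)
    have h3 := hM (p.1 + w) p.2 ⟨ht.1, (hIcc _ ht).2⟩
    have h4 := hm p.1 p.2 (hIcc _ ht)
    have h5 : k * ‖w‖ ^ 2 ≤ k * 1 := by
      gcongr; exact pow_le_one₀ (norm_nonneg _) hw
    rw [hR]
    change m ≤ φf p at h4
    linarith [le_abs_self (M - m)]
  set K₁ := k * (1 + R) ^ 2 + L * (2 + R) with hK₁
  set K₂ := 2 * k * (1 + R) ^ 2 + L * (3 + R) + L ^ 2 with hK₂
  have hK₁0 : 0 ≤ K₁ := by positivity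
  have hK₂0 : 0 ≤ K₂ := by positivity
  -- The lower expansion of `φb` at the later point `p'` lies under the propagated upper expansion
  -- of `φf` from `p`; the propagated lower one removes the value at `p'`. What remains is `inner (v
  -- p' - v p) w ≤ const * r²` for `‖w‖ ≤ r`.
  have hgrad : ∀ p ∈ reversibilitySet T φf φb, ∀ p' ∈ reversibilitySet T φf φb,
      p.2 ∈ Icc a b → p'.2 ∈ Icc a b → p.2 ≤ p'.2 → (p'.2 - p.2) * (2 * L + 4 * k + 1) ≤ 1 →
      ‖v p' - v p‖ ≤ (k + 4 * K₁ + K₂) * (‖p'.1 - p.1‖ + (p'.2 - p.2)) := by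
    intro p hp p' hp' ht ht' hle hsm
    obtain ⟨r, hr⟩ : ∃ r, r = ‖p'.1 - p.1‖ + (p'.2 - p.2) := ⟨_, rfl⟩
    have hr0 : 0 ≤ r := by rw [hr]; linarith [norm_nonneg (p'.1 - p.1)]
    rcases hr0.eq_or_lt with h0 | hr0
    · have h1 : p'.1 - p.1 = 0 := norm_le_zero_iff.1 (by linarith)
      have h2 : p'.2 = p.2 := by linarith [norm_nonneg (p'.1 - p.1)]
      have : p' = p := Prod.ext (sub_eq_zero.1 h1) h2
      rw [← hr, ← h0, this]; simp
    rw [← hr]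
    refine norm_le_of_inner_le hr0 (fun w hw => ?_) (by positivity)
    obtain ⟨ξ, hξ⟩ : ∃ ξ, ξ = p'.1 - p.1 := ⟨_, rfl⟩
    have hx : p'.1 = p.1 + ξ := by rw [hξ]; abel
    have h1 := hqb p' hp' ht' w
    have h2 := hφ.le hT (p'.1 + w) (hIcc _ ht')
    have h3 := hφ.forward.upper_of_later hP (hIcc _ ht).1 hle (hIcc _ ht').2 hk (hvR p hp ht)
      (hqf p hp ht) (ξ + w)
    have h4 := hφ.forward.lower_of_later hP (hIcc _ ht).1 hle (hIcc _ ht').2 hk (hvR p hp ht) hsm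
      (fun η => (hqb p hp ht η).trans (hφ.le hT _ (hIcc _ ht))) ξ
    rw [← hK₁] at h3
    rw [← hK₂, ← hx, hξ, ← hr, ← hξ] at h4
    rw [inner_add_right, ← add_assoc, ← hx] at h3
    have h5 : K₁ * (‖ξ + w‖ + (p'.2 - p.2)) ^ 2 ≤ K₁ * (2 * r) ^ 2 := by
      have : 0 ≤ p'.2 - p.2 := by linarith
      have := norm_add_le ξ w
      rw [hξ] at this ⊢
      gcongr
      linarith
    have h6 : k * ‖w‖ ^ 2 ≤ k * r ^ 2 := by gcongr
    rw [inner_sub_left]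
    change _ ≤ φf p' at h4
    linarith
  obtain ⟨h₀, hh₀⟩ : ∃ h₀, h₀ = 1 / (2 * L + 4 * k + 1) := ⟨_, rfl⟩
  have hden : 0 < 2 * L + 4 * k + 1 := by positivity
  have hh₀0 : 0 < h₀ := by rw [hh₀]; positivity
  set N : ℝ := 2 * (k + 4 * K₁ + K₂) with hN
  have hN0 : 0 ≤ N := by positivity
  -- Times in `U` differ by at most `h₀`, as the short-time condition requires.
  set U : Set (Space n × ℝ) := {p | p.2 ∈ Icc a b ∧ |p.2 - ts| ≤ h₀ / 2} with hU
  have hUnhds : U ∈ nhds (xs, ts) := by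
    have h1 : ∀ᶠ t in nhds ts, t ∈ Icc a b ∧ |t - ts| ≤ h₀ / 2 := by
      refine Filter.Eventually.and (Icc_mem_nhds (by linarith [hts.1]) (by linarith [hts.2])) ?_
      have := Metric.closedBall_mem_nhds ts (half_pos hh₀0)
      filter_upwards [this] with t ht
      rwa [Metric.mem_closedBall, Real.dist_eq] at ht
    exact (continuous_snd.tendsto (xs, ts)).eventually h1
  have hgrad' : ∀ p ∈ reversibilitySet T φf φb ∩ U, ∀ p' ∈ reversibilitySet T φf φb ∩ U,
      ‖v p - v p'‖ ≤ N * dist p p' := by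
    have key : ∀ p ∈ reversibilitySet T φf φb ∩ U, ∀ p' ∈ reversibilitySet T φf φb ∩ U,
        p.2 ≤ p'.2 → ‖v p' - v p‖ ≤ N * dist p' p := by
      rintro p ⟨hp, ht, hd⟩ p' ⟨hp', ht', hd'⟩ hle
      have hsm : (p'.2 - p.2) * (2 * L + 4 * k + 1) ≤ 1 := by
        rw [← le_div_iff₀ hden, ← hh₀]
        linarith [(abs_le.1 hd).1, (abs_le.1 hd').2]
      refine (hgrad p hp p' hp' ht ht' hle hsm).trans ?_
      have h1 : ‖p'.1 - p.1‖ ≤ dist p' p := by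
        rw [← dist_eq_norm, Prod.dist_eq]; exact le_max_left _ _
      have h2 : p'.2 - p.2 ≤ dist p' p := by
        refine (le_abs_self _).trans ?_
        rw [← Real.dist_eq, Prod.dist_eq]; exact le_max_right _ _
      calc _ ≤ (k + 4 * K₁ + K₂) * (dist p' p + dist p' p) := by gcongr
        _ = _ := by rw [hN]; ring
    intro p hp p' hp'
    rcases le_total p.2 p'.2 with h | h
    · rw [norm_sub_rev, dist_comm]; exact key p hp p' hp' h
    · exact key p' hp' p hp h
  refine ⟨(N + (2 * L + R * N)).toNNReal, reversibilitySet T φf φb ∩ U,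
    Filter.inter_mem self_mem_nhdsWithin (mem_nhdsWithin_of_mem_nhds hUnhds),
    LipschitzOnWith.of_dist_le_mul fun p hp p' hp' => ?_⟩
  rw [Real.coe_toNNReal _ (by positivity), fullGradient_of_hasFDerivAt (hvf p hp.1),
    fullGradient_of_hasFDerivAt (hvf p' hp'.1), Prod.dist_eq]
  have hd0 : 0 ≤ dist p p' := dist_nonneg
  have h1 := hgrad' p hp p' hp'
  have h2 := hP.lip p.1 p'.1 p.2 (hIcc _ hp.2.1) p'.2 (hIcc _ hp'.2.1)
  have h3 : ‖p.1 - p'.1‖ ≤ dist p p' := by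
    rw [← dist_eq_norm, Prod.dist_eq]; exact le_max_left _ _
  have h4 : |p.2 - p'.2| ≤ dist p p' := by
    rw [← Real.dist_eq, Prod.dist_eq]; exact le_max_right _ _
  have hLd : L * (‖p.1 - p'.1‖ + |p.2 - p'.2|) ≤ 2 * L * dist p p' := by
    calc _ ≤ L * (dist p p' + dist p p') := by gcongr
      _ = _ := by ring
  refine max_le ?_ ?_
  · rw [dist_eq_norm]
    refine h1.trans ?_
    gcongr
    have : 0 ≤ 2 * L + R * N := by positivity
    linarith
  · rw [Real.dist_eq]
    have h5 : |‖v p‖ ^ 2 / 2 - ‖v p'‖ ^ 2 / 2| ≤ R * N * dist p p' := by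
      have e : ‖v p‖ ^ 2 / 2 - ‖v p'‖ ^ 2 / 2 =
          (‖v p‖ + ‖v p'‖) / 2 * (‖v p‖ - ‖v p'‖) := by ring
      rw [e, abs_mul, abs_of_nonneg (by positivity), mul_assoc]
      gcongr
      · linarith [hvR p hp.1 hp.2.1, hvR p' hp'.1 hp'.2.1]
      · exact (abs_norm_sub_norm_le _ _).trans h1
    have h6 : 0 ≤ N * dist p p' := by positivity
    have e : P p - ‖v p‖ ^ 2 / 2 - (P p' - ‖v p'‖ ^ 2 / 2) =
        (P p - P p') - (‖v p‖ ^ 2 / 2 - ‖v p'‖ ^ 2 / 2) := by ring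
    rw [e]
    refine (abs_sub _ _).trans ?_
    change |P p - P p'| ≤ _ at h2
    linarith

end

end HamiltonJacobi

end

/-! ### Conclusion for both members of the pair -/

theorem lemma4p9 (n : ℕ) (T : ℝ) (hT : 0 < T)
    (P : HamiltonJacobi.Space n × ℝ → ℝ)
    (hPper : HamiltonJacobi.IsTorusFunction T P)
    (hP : ContDiffOn ℝ 1 P (Set.univ ×ˢ Set.Icc (0 : ℝ) T))
    (φf φb : HamiltonJacobi.Space n × ℝ → ℝ)
    (hφ : HamiltonJacobi.IsReversiblePair T P φf φb) :
    (∀ p ∈ HamiltonJacobi.reversibilitySet T φf φb,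
      DifferentiableAt ℝ φf p ∧ DifferentiableAt ℝ φb p ∧
      HamiltonJacobi.fullGradient φf p = HamiltonJacobi.fullGradient φb p ∧
      HamiltonJacobi.SatisfiesHJAt P φf p ∧ HamiltonJacobi.SatisfiesHJAt P φb p) ∧
    (HamiltonJacobi.IsSemiconcavePressure T P →
      LocallyLipschitzOn (HamiltonJacobi.reversibilitySet T φf φb)
        (HamiltonJacobi.fullGradient φf) ∧
      LocallyLipschitzOn (HamiltonJacobi.reversibilitySet T φf φb)
        (HamiltonJacobi.fullGradient φb)) := by
  obtain ⟨B, L, hBL⟩ := HamiltonJacobi.exists_lipschitzPressure hPper hP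
  have hmain : ∀ p ∈ HamiltonJacobi.reversibilitySet T φf φb,
      DifferentiableAt ℝ φf p ∧ DifferentiableAt ℝ φb p ∧
      HamiltonJacobi.fullGradient φf p = HamiltonJacobi.fullGradient φb p ∧
      HamiltonJacobi.SatisfiesHJAt P φf p ∧ HamiltonJacobi.SatisfiesHJAt P φb p := by
    intro p hp
    obtain ⟨v, hf, hb⟩ := hφ.exists_hasFDerivAt hBL hT hp
    have ef := HamiltonJacobi.fullGradient_of_hasFDerivAt hf
    have eb := HamiltonJacobi.fullGradient_of_hasFDerivAt hb
    refine ⟨hf.differentiableAt, hb.differentiableAt, ef.trans eb.symm, ?_, ?_⟩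
    · have h1 : HamiltonJacobi.spaceGradient φf p = v := congrArg Prod.fst ef
      have h2 : HamiltonJacobi.timeDerivative φf p = _ := congrArg Prod.snd ef
      rw [HamiltonJacobi.SatisfiesHJAt, h1, h2, sub_add_cancel]
    · have h1 : HamiltonJacobi.spaceGradient φb p = v := congrArg Prod.fst eb
      have h2 : HamiltonJacobi.timeDerivative φb p = _ := congrArg Prod.snd eb
      rw [HamiltonJacobi.SatisfiesHJAt, h1, h2, sub_add_cancel]
  refine ⟨hmain, fun hsc => ?_⟩
  have hlip := hφ.locallyLipschitzOn_fullGradient hBL hT hsc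
  refine ⟨hlip, fun p hp => ?_⟩
  obtain ⟨K, t, ht, hK⟩ := hlip hp
  -- The two gradients agree only on `K₀`, so the neighbourhood is intersected with it before the
  -- bound is transferred.
  refine ⟨K, t ∩ HamiltonJacobi.reversibilitySet T φf φb,
    Filter.inter_mem ht self_mem_nhdsWithin, fun x hx y hy => ?_⟩
  rw [← (hmain x hx.2).2.2.1, ← (hmain y hy.2).2.2.1]
  exact hK hx.1 hy.1
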